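/- **Theorem 1.2.** Let $n,m\ge 0$ be integers, $N=n+m$, $a_1<a_2$, $a=a_2-a_1$, and let $\nu_1<\dots<\nu_N$ be real with $\nu_j<0$ for $1\le j\le n$ and $\nu_j>0$ for $n<j\le N$. Let $0<s,t<1$ and $u,v\in\mathbb R$. Put $p_r(x,y)=(2\pi r)^{-1/2}e^{-(x-y)^2/(2r)}$ for $r>0$ and $p_r(x,y)=0$ for $r\le 0$. For an integer $K\ge 1$ let $\mu_j=a_1+a(j-1)/K$ for $1\le j\le n$, $\mu_j=a_2+a(j-1)/K$ for $n<j\le N$, $A=(p_1(\mu_i,\nu_j))_{i,j=1}^N$, and $$\mathcal L_{K,m,n}(s,u,t,v;\nu)=e^{\frac{u^2}{2(1-s)}-\frac{v^2}{2(1-t)}}\Big(-p_{t-s}(u,v)+\sum_{j,k=1}^N p_{1-s}(u,\nu_k)(A^{-1})_{kj}\,p_t(\mu_j,v)\Big),$$ $$q(s,u,t,v)=e^{\frac{u^2}{2(1-s)}-\frac{v^2}{2(1-t)}}p_{t-s}(u,v).$$ Let $\gamma_1\subset\{\operatorname{Re}z<0\}$ and $\gamma_2\subset\{\operatorname{Re}z>0\}$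 be closed piecewise $C^1$ curves such that $\gamma_1$ winds exactly once counterclockwise around each of $\nu_1,\dots,\nu_n$, and $\gamma_2$ around each of $\nu_{n+1},\dots,\nu_{N}$ (for example, counterclockwise simple closed contours with these points in their interior). Let $\Gamma_c$ be the upward vertical line through $c\in\mathbb R$, let $c\ge 0\ge c'$, and let $d_1,d_2$ be non-zero complex numbers. Write $E_{\alpha}(w)=e^{\frac{t}{2(1-t)}w^2+\alpha w-\frac{vw}{1-t}}$ and $e_{\alpha}(z)=e^{-\frac{s}{2(1-s)}z^2-\alpha z+\frac{uz}{1-s}}$. Define, for $x,y\ge 1$, $$\mathcal B(x)=\frac{d_2\sqrt a}{(2\pi i)^2\sqrt{1-t}}\int_{\Gamma_c}dw\int_{\gamma_1}d\zeta\,E_{a_1}(w)\prod_{j=1}^n\frac{w/\nu_j-1}{\zeta/\nu_j-1}\prod_{j=1}^m\Big(1-\frac{\zeta}{\nu_{n+j}}\Big)\frac{e^{ax\zeta}}{\zeta-w},$$ $$\beta(x)=\frac{d_2\sqrt a}{2\pi i\sqrt{1-t}}\int_{\Gamma_0}dw\,E_{a_1}(w)e^{axw}\prod_{j=1}^m\Big(1-\frac{w}{\nu_{n+j}}\Big),$$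 $$\mathcal C(y)=\frac{d_1\sqrt a}{(2\pi i)^2\sqrt{1-s}}\int_{\gamma_1}dz\int_{\gamma_2}d\omega\,e_{a_1}(z)\prod_{j=1}^n\frac{\omega/\nu_j-1}{z/\nu_j-1}\prod_{j=1}^m\frac1{1-\omega/\nu_{n+j}}\frac{e^{-ay\omega}}{\omega-z},$$ $$M_0(x,y)=\frac a{(2\pi i)^2}\int_{\gamma_1}d\zeta\int_{\gamma_2}d\omega\,\frac{e^{ax\zeta-ay\omega}}{\zeta-\omega}\prod_{j=1}^n\frac{1-\omega/\nu_j}{1-\zeta/\nu_j}\prod_{j=1}^m\frac{1-\zeta/\nu_{n+j}}{1-\omega/\nu_{n+j}},$$ and $$\hat{\mathcal B}(x)=\frac{d_2\sqrt a}{(2\pi i)^2\sqrt{1-t}}\int_{\Gamma_{c'}}dw\int_{\gamma_2}d\zeta\,E_{a_2}(w)\prod_{j=1}^m\frac{w/\nu_{n+j}-1}{\zeta/\nu_{n+j}-1}\prod_{j=1}^n\Big(\frac{\zeta}{\nu_j}-1\Big)\frac{e^{-ax\zeta}}{\zeta-w},$$ $$\hat\beta(x)=\frac{d_2\sqrt a}{2\pi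 i\sqrt{1-t}}\int_{\Gamma_0}dw\,E_{a_2}(w)e^{-axw}\prod_{j=1}^n\Big(\frac{w}{\nu_j}-1\Big),$$ $$\hat{\mathcal C}(y)=\frac{d_1\sqrt a}{(2\pi i)^2\sqrt{1-s}}\int_{\gamma_2}dz\int_{\gamma_1}d\omega\,e_{a_2}(z)\prod_{j=1}^m\frac{1-\omega/\nu_{n+j}}{1-z/\nu_{n+j}}\prod_{j=1}^n\frac1{\omega/\nu_j-1}\frac{e^{ay\omega}}{z-\omega},$$ $$\hat M_0(x,y)=\frac a{(2\pi i)^2}\int_{\gamma_2}d\zeta\int_{\gamma_1}d\omega\,\frac{e^{-ax\zeta+ay\omega}}{\omega-\zeta}\prod_{j=1}^m\frac{1-\omega/\nu_{n+j}}{1-\zeta/\nu_{n+j}}\prod_{j=1}^n\frac{1-\zeta/\nu_j}{1-\omega/\nu_j}.$$ All determinants below are Fredholm determinants on $L^2[1,\infty)$ of finite-rank perturbations of the identity, $\det(I+T)=\sum_{k\ge0}\frac1{k!}\int_{[1,\infty)^k}\det(T(x_i,x_j))_{i,j=1}^k\,d^kx$, and $(f\otimes g)(x,y)=f(x)g(y)$.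 Define $L_{m,n}$ and $\hat L_{m,n}$ by $$d_1d_2L_{m,n}=\frac{d_1d_2}{(2\pi i)^2\sqrt{(1-s)(1-t)}}\int_{\Gamma_0}dw\int_{\gamma_1}dz\,\frac{e_{a_1}(z)E_{a_1}(w)}{w-z}\prod_{j=1}^n\frac{1-w/\nu_j}{1-z/\nu_j}+\frac{\det(I-M_0+(\mathcal B+\beta)\otimes\mathcal C)}{\det(I-M_0)}-1,$$ $$d_1d_2\hat L_{m,n}=\frac{d_1d_2}{(2\pi i)^2\sqrt{(1-s)(1-t)}}\int_{\Gamma_0}dw\int_{\gamma_2}dz\,\frac{e_{a_2}(z)E_{a_2}(w)}{w-z}\prod_{j=1}^m\frac{1-w/\nu_{n+j}}{1-z/\nu_{n+j}}+\frac{\det(I-\hat M_0+(\hat{\mathcal B}+\hat\beta)\otimes\hat{\mathcal C})}{\det(I-\hat M_0)}-1.$$ Then these expressions are well defined, in that $\det A\ne0$ for every $K\ge1$, $\det(I-M_0)\ne0$ and $\det(I-\hat M_0)\ne0$, and $$\lim_{K\to\infty}\mathcal L_{K,m,n}(s,u,t,v;\nu)=L_{m,n}+\hat L_{m,n}-q(s,u,t,v).$$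 -/

import Mathlib

open Filter Topology

noncomputable section

namespace NonColliding

/-! ### The correlation kernel of finitely many non-colliding Brownian motions -/

/-- The Brownian transition density `p_t(x, y)`, extended by `0` to `t ≤ 0`. -/
def heatKernel (t x y : ℝ) : ℝ :=
  if 0 < t then 1 / Real.sqrt (2 * Real.pi * t) * Real.exp (-(x - y) ^ 2 / (2 * t)) else 0

/-- The matrix `A = (p_1(μ_i, ν_j))`. -/
def transitionMatrix {N : ℕ} (μ ν : Fin N → ℝ) : Matrix (Fin N) (Fin N) ℝ :=
  Matrix.of fun i j => heatKernel 1 (μ i) (ν j)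

/-- The extended correlation kernel of `N` non-colliding Brownian motions that start at
`μ_1, …, μ_N` at time `0` and end at `ν_1, …, ν_N` at time `1`. -/
def brownianKernel {N : ℕ} (μ ν : Fin N → ℝ) (s u t v : ℝ) : ℝ :=
  -heatKernel (t - s) u v +
    ∑ j, ∑ k, heatKernel (1 - s) u (ν k) * (transitionMatrix μ ν)⁻¹ k j * heatKernel t (μ j) v

/-- The starting points: `n` of them near `a₁` and `m` near `a₂`, with spacing `(a₂ - a₁) / K`.
The index `j` runs from `0` here, so that it stands for `j - 1` in one-based numbering. -/
def startPoints (n m : ℕ) (a₁ a₂ : ℝ) (K : ℕ) : Fin (n + m) → ℝ := fun j =>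
  (if (j : ℕ) < n then a₁ else a₂) + (a₂ - a₁) * ((j : ℕ) : ℝ) / (K : ℝ)

/-- The conjugating factor `exp(u²/(2(1-s)) - v²/(2(1-t)))`. -/
def conjFactor (s u t v : ℝ) : ℝ :=
  Real.exp (u ^ 2 / (2 * (1 - s)) - v ^ 2 / (2 * (1 - t)))

/-- The conjugated kernel `𝓛_{K,m,n}(s,u,t,v;ν)`. -/
def kernelK {n m : ℕ} (a₁ a₂ : ℝ) (ν : Fin (n + m) → ℝ) (K : ℕ) (s u t v : ℝ) : ℝ :=
  conjFactor s u t v * brownianKernel (startPoints n m a₁ a₂ K) ν s u t v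

/-- The function `q(s,u,t,v)`. -/
def q (s u t v : ℝ) : ℝ := conjFactor s u t v * heatKernel (t - s) u v

/-! ### Contour integrals and Fredholm determinants -/

/-- The integral of `f` along the upward vertical line `Γ_c`, `y ↦ c + i y`. -/
def lineIntegral (c : ℝ) (f : ℂ → ℂ) : ℂ :=
  Complex.I * ∫ y : ℝ, f ((c : ℂ) + (y : ℂ) * Complex.I)

/-- The integral of `f` along a piecewise `C¹` curve parametrized by `[0, 1]`. -/
def contourIntegral (γ : ℝ → ℂ) (f : ℂ → ℂ) : ℂ :=
  ∫ τ in (0 : ℝ)..1, f (γ τ) * deriv γ τ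

/-- `γ`, restricted to `[0, 1]`, is a closed piecewise `C¹` curve in `U` that avoids the points
`p j` and winds exactly once counterclockwise about each of them. This holds in particular for
every piecewise `C¹` simple closed contour in `U`, counterclockwise oriented, that contains
all the `p j` in its interior. -/
structure IsContour {ι : Type*} (γ : ℝ → ℂ) (U : Set ℂ) (p : ι → ℂ) : Prop where
  continuousOn : ContinuousOn γ (Set.Icc 0 1)
  closed : γ 0 = γ 1
  piecewise_C1 : ∃ S : Finset ℝ, ∃ B : ℝ, ∀ τ ∈ Set.Ioo (0 : ℝ) 1, τ ∉ S →
    DifferentiableAt ℝ γ τ ∧ ContinuousAt (deriv γ) τ ∧ ‖deriv γ τ‖ ≤ B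
  mapsTo : Set.MapsTo γ (Set.Icc 0 1) U
  avoids : ∀ j, ∀ τ ∈ Set.Icc (0 : ℝ) 1, γ τ ≠ p j
  winding : ∀ j, contourIntegral γ (fun z => (z - p j)⁻¹) = 2 * (Real.pi : ℂ) * Complex.I

/-- The Fredholm determinant `det(I + T)` on `L²(S)` of the integral operator with kernel
`T(x, y)`, given by the Fredholm expansion. If `T(x, y)` is a finite sum of products
`f_i(x) g_i(y)`, then the expansion terminates. -/
def fredholmDet (S : Set ℝ) (T : ℝ → ℝ → ℂ) : ℂ :=
  ∑' k : ℕ, (1 / (k.factorial : ℂ)) *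
    ∫ x in Set.pi Set.univ (fun _ : Fin k => S), (Matrix.of fun i j => T (x i) (x j)).det

/-! ### The functions entering the limiting kernel

Throughout, `ν (Fin.castAdd m j)`, for `j : Fin n`, are the left endpoints `ν_1, …, ν_n` and
`ν (Fin.natAdd n j)`, for `j : Fin m`, are the right endpoints `ν_{n+1}, …, ν_{n+m}`. -/

/-- The exponential factor `exp(t w²/(2(1-t)) + α w - v w/(1-t))`. -/
def expW (α t v : ℝ) (w : ℂ) : ℂ :=
  Complex.exp ((t : ℂ) / (2 * (1 - t)) * w ^ 2 + α * w - v * w / (1 - t))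

/-- The exponential factor `exp(-s z²/(2(1-s)) - α z + u z/(1-s))`. -/
def expZ (α s u : ℝ) (z : ℂ) : ℂ :=
  Complex.exp (-((s : ℂ) / (2 * (1 - s))) * z ^ 2 - α * z + u * z / (1 - s))

section LimitFunctions

variable {n m : ℕ} (a₁ a₂ : ℝ) (ν : Fin (n + m) → ℝ) (γ₁ γ₂ : ℝ → ℂ)

/-- The function `𝓑_{v,t}(x)`; the contour of `w` is the line `Γ_c`. -/
def B (d₂ : ℂ) (c v t x : ℝ) : ℂ :=
  d₂ * (Real.sqrt (a₂ - a₁) : ℂ) /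
      ((2 * (Real.pi : ℂ) * Complex.I) ^ 2 * (Real.sqrt (1 - t) : ℂ)) *
    lineIntegral c fun w => contourIntegral γ₁ fun ζ =>
      expW a₁ t v w *
        (∏ j : Fin n, (w / ν (Fin.castAdd m j) - 1) / (ζ / ν (Fin.castAdd m j) - 1)) *
        (∏ j : Fin m, (1 - ζ / ν (Fin.natAdd n j))) *
        (Complex.exp (((a₂ - a₁ : ℝ) : ℂ) * x * ζ) / (ζ - w))

/-- The function `β_{v,t}(x)`. -/
def β (d₂ : ℂ) (v t x : ℝ) : ℂ :=
  d₂ * (Real.sqrt (a₂ - a₁) : ℂ) /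
      (2 * (Real.pi : ℂ) * Complex.I * (Real.sqrt (1 - t) : ℂ)) *
    lineIntegral 0 fun w =>
      expW a₁ t v w * Complex.exp (((a₂ - a₁ : ℝ) : ℂ) * x * w) *
        ∏ j : Fin m, (1 - w / ν (Fin.natAdd n j))

/-- The function `𝓒_{u,s}(y)`. -/
def C (d₁ : ℂ) (u s y : ℝ) : ℂ :=
  d₁ * (Real.sqrt (a₂ - a₁) : ℂ) /
      ((2 * (Real.pi : ℂ) * Complex.I) ^ 2 * (Real.sqrt (1 - s) : ℂ)) *
    contourIntegral γ₁ fun z => contourIntegral γ₂ fun ω =>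
      expZ a₁ s u z *
        (∏ j : Fin n, (ω / ν (Fin.castAdd m j) - 1) / (z / ν (Fin.castAdd m j) - 1)) *
        (∏ j : Fin m, 1 / (1 - ω / ν (Fin.natAdd n j))) *
        (Complex.exp (-(((a₂ - a₁ : ℝ) : ℂ) * y * ω)) / (ω - z))

/-- The kernel `M₀(x, y)`. -/
def M₀ (x y : ℝ) : ℂ :=
  ((a₂ - a₁ : ℝ) : ℂ) / (2 * (Real.pi : ℂ) * Complex.I) ^ 2 *
    contourIntegral γ₁ fun ζ => contourIntegral γ₂ fun ω =>
      Complex.exp (((a₂ - a₁ : ℝ) : ℂ) * x * ζ - ((a₂ - a₁ : ℝ) : ℂ) * y * ω) *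
        (1 / (ζ - ω)) *
        (∏ j : Fin n, (1 - ω / ν (Fin.castAdd m j)) / (1 - ζ / ν (Fin.castAdd m j))) *
        (∏ j : Fin m, (1 - ζ / ν (Fin.natAdd n j)) / (1 - ω / ν (Fin.natAdd n j)))

/-- The function `𝓑̂_{v,t}(x)`; the contour of `w` is the line `Γ_c`. -/
def BHat (d₂ : ℂ) (c v t x : ℝ) : ℂ :=
  d₂ * (Real.sqrt (a₂ - a₁) : ℂ) /
      ((2 * (Real.pi : ℂ) * Complex.I) ^ 2 * (Real.sqrt (1 - t) : ℂ)) *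
    lineIntegral c fun w => contourIntegral γ₂ fun ζ =>
      expW a₂ t v w *
        (∏ j : Fin m, (w / ν (Fin.natAdd n j) - 1) / (ζ / ν (Fin.natAdd n j) - 1)) *
        (∏ j : Fin n, (ζ / ν (Fin.castAdd m j) - 1)) *
        (Complex.exp (-(((a₂ - a₁ : ℝ) : ℂ) * x * ζ)) / (ζ - w))

/-- The function `β̂_{v,t}(x)`. -/
def βHat (d₂ : ℂ) (v t x : ℝ) : ℂ :=
  d₂ * (Real.sqrt (a₂ - a₁) : ℂ) /
      (2 * (Real.pi : ℂ) * Complex.I * (Real.sqrt (1 - t) : ℂ)) *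
    lineIntegral 0 fun w =>
      expW a₂ t v w * Complex.exp (-(((a₂ - a₁ : ℝ) : ℂ) * x * w)) *
        ∏ j : Fin n, (w / ν (Fin.castAdd m j) - 1)

/-- The function `𝓒̂_{u,s}(y)`. -/
def CHat (d₁ : ℂ) (u s y : ℝ) : ℂ :=
  d₁ * (Real.sqrt (a₂ - a₁) : ℂ) /
      ((2 * (Real.pi : ℂ) * Complex.I) ^ 2 * (Real.sqrt (1 - s) : ℂ)) *
    contourIntegral γ₂ fun z => contourIntegral γ₁ fun ω =>
      expZ a₂ s u z *
        (∏ j : Fin m, (1 - ω / ν (Fin.natAdd n j)) / (1 - z / ν (Fin.natAdd n j))) *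
        (∏ j : Fin n, 1 / (ω / ν (Fin.castAdd m j) - 1)) *
        (Complex.exp (((a₂ - a₁ : ℝ) : ℂ) * y * ω) / (z - ω))

/-- The kernel `M̂₀(x, y)`. -/
def MHat₀ (x y : ℝ) : ℂ :=
  ((a₂ - a₁ : ℝ) : ℂ) / (2 * (Real.pi : ℂ) * Complex.I) ^ 2 *
    contourIntegral γ₂ fun ζ => contourIntegral γ₁ fun ω =>
      Complex.exp (-(((a₂ - a₁ : ℝ) : ℂ) * x * ζ) + ((a₂ - a₁ : ℝ) : ℂ) * y * ω) *
        (1 / (ω - ζ)) *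
        (∏ j : Fin m, (1 - ω / ν (Fin.natAdd n j)) / (1 - ζ / ν (Fin.natAdd n j))) *
        (∏ j : Fin n, (1 - ζ / ν (Fin.castAdd m j)) / (1 - ω / ν (Fin.castAdd m j)))

/-- `det(I - M₀)` on `L²[1, ∞)`. -/
def detM₀ : ℂ := fredholmDet (Set.Ici 1) fun x y => -M₀ a₁ a₂ ν γ₁ γ₂ x y

/-- `det(I - M̂₀)` on `L²[1, ∞)`. -/
def detMHat₀ : ℂ := fredholmDet (Set.Ici 1) fun x y => -MHat₀ a₁ a₂ ν γ₁ γ₂ x y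

/-- `det(I - M₀ + (𝓑_{v,t} + β_{v,t}) ⊗ 𝓒_{u,s})` on `L²[1, ∞)`. -/
def detPerturbed (d₁ d₂ : ℂ) (c s u t v : ℝ) : ℂ :=
  fredholmDet (Set.Ici 1) fun x y =>
    -M₀ a₁ a₂ ν γ₁ γ₂ x y +
      (B a₁ a₂ ν γ₁ d₂ c v t x + β a₁ a₂ ν d₂ v t x) * C a₁ a₂ ν γ₁ γ₂ d₁ u s y

/-- `det(I - M̂₀ + (𝓑̂_{v,t} + β̂_{v,t}) ⊗ 𝓒̂_{u,s})` on `L²[1, ∞)`. -/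
def detPerturbedHat (d₁ d₂ : ℂ) (c s u t v : ℝ) : ℂ :=
  fredholmDet (Set.Ici 1) fun x y =>
    -MHat₀ a₁ a₂ ν γ₁ γ₂ x y +
      (BHat a₁ a₂ ν γ₂ d₂ c v t x + βHat a₁ a₂ ν d₂ v t x) * CHat a₁ a₂ ν γ₁ γ₂ d₁ u s y

/-- The kernel `L_{m,n}(s,u,t,v;ν)`: its product with `d₁ d₂` is `d₁ d₂` times a double contour
integral, plus a ratio of Fredholm determinants, minus `1`. -/
def L (d₁ d₂ : ℂ) (c s u t v : ℝ) : ℂ :=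
  (d₁ * d₂)⁻¹ *
    (d₁ * d₂ / ((2 * (Real.pi : ℂ) * Complex.I) ^ 2 * (Real.sqrt ((1 - s) * (1 - t)) : ℂ)) *
        (lineIntegral 0 fun w => contourIntegral γ₁ fun z =>
          1 / (w - z) * (expZ a₁ s u z * expW a₁ t v w) *
            ∏ j : Fin n, (1 - w / ν (Fin.castAdd m j)) / (1 - z / ν (Fin.castAdd m j))) +
      detPerturbed a₁ a₂ ν γ₁ γ₂ d₁ d₂ c s u t v / detM₀ a₁ a₂ ν γ₁ γ₂ - 1)

/-- The kernel `L̂_{m,n}(s,u,t,v;ν)`. -/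
def LHat (d₁ d₂ : ℂ) (c s u t v : ℝ) : ℂ :=
  (d₁ * d₂)⁻¹ *
    (d₁ * d₂ / ((2 * (Real.pi : ℂ) * Complex.I) ^ 2 * (Real.sqrt ((1 - s) * (1 - t)) : ℂ)) *
        (lineIntegral 0 fun w => contourIntegral γ₂ fun z =>
          1 / (w - z) * (expZ a₂ s u z * expW a₂ t v w) *
            ∏ j : Fin m, (1 - w / ν (Fin.natAdd n j)) / (1 - z / ν (Fin.natAdd n j))) +
      detPerturbedHat a₁ a₂ ν γ₁ γ₂ d₁ d₂ c s u t v / detMHat₀ a₁ a₂ ν γ₁ γ₂ - 1)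

/-- The limiting kernel `𝓛_{m,n} = L_{m,n} + L̂_{m,n} - q`. The lines `Γ_c` and `Γ_{c'}` are used
in `𝓑_{v,t}` and in `𝓑̂_{v,t}`, respectively. -/
def limitKernel (d₁ d₂ : ℂ) (c c' s u t v : ℝ) : ℂ :=
  L a₁ a₂ ν γ₁ γ₂ d₁ d₂ c s u t v + LHat a₁ a₂ ν γ₁ γ₂ d₁ d₂ c' s u t v - (q s u t v : ℂ)

end LimitFunctions

end NonColliding

end

/-! The proof rests on an interpolation problem that both sides of the limit solve.

Up to Gaussian factors, the matrix `A` consists of the values `exp (μ_i ν_j)`, and `p_t(μ, v)` is the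
integral of `exp (μ w)` over the imaginary axis against the Gaussian weight `expW 0 t v`. Hence
`kernelK + q` is a Gaussian moment of the function `∑ j, c j * exp (μ_j w)` that takes the values
`expZ 0 s u (ν_k)` at the points `ν_k` (`kernelK_add_q_eq`). The `μ_j` coalesce at `a₁` and `a₂` as
`K → ∞`, so that these functions converge to an exponential polynomial
`exp (a₁ w) P(w) + exp (a₂ w) Q(w)` with `deg P < n`, `deg Q < m` and the same values at the `ν_k`
(`tendsto_kernelK_add_q`). Such interpolants are unique, since an exponential polynomial of this
kind has fewer than `n + m` real zeros, by Rolle's theorem (`expPoly_eq_zero`); in the same way, a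
sum of `N` exponentials has fewer than `N` real zeros, which gives `det A ≠ 0`.

On the other side, all contour integrals over `γ₁` and `γ₂` are sums of residues at simple poles, by
`IsContour.integral_mul_inv_rootProd`, and the residues are Lagrange basis polynomials of the two
groups of end points. In particular the kernels have finite rank, and by Andréief's identity their
Fredholm determinants are determinants of matrices (`fredholmDet_finite_rank`). The matrix of
`I - M₀` is `1 - crossMatrix`, where the cross matrix interpolates back and forth between the two
groups of points. A vector in its kernel would give an exponential polynomial with too many zeros,
so that `det (I - M₀) ≠ 0`. The ratio of determinants is a rank-one update; solving the linear system
shows that `L` is a Gaussian moment of the exponential polynomial that takes the required values at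
the negative `ν_k` and vanishes at the positive ones (`exists_interpolating_expPoly`). For `LHat`,
the groups exchange their roles; a sign `ε = ±1` covers both cases at once. The sum of the
two exponential polynomials solves the full interpolation problem, so it is the limit above. -/

namespace NonColliding

open MeasureTheory

/-! ### Fredholm determinants of kernels of finite rank -/

section Fredholm

variable {ι : Type*} [Fintype ι] [DecidableEq ι]

/-- Non-injective index maps contribute `0`, and each set of `k` indices is the image of `k!`
injective ones. -/
theorem sum_det_submatrix (X : Matrix ι ι ℂ) (k : ℕ) :
    ∑ φ : Fin k → ι, (X.submatrix φ φ).det =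
      (k.factorial : ℂ) * ∑ S ∈ Finset.univ.powersetCard k,
        (X.submatrix (Subtype.val : S → ι) (Subtype.val : S → ι)).det := by
  classical
  have h1 : ∑ φ : Fin k → ι, (X.submatrix φ φ).det =
      ∑ φ : Fin k → ι with Function.Injective φ, (X.submatrix φ φ).det := by
    symm
    apply Finset.sum_filter_of_ne
    intro φ _ hφ
    by_contra hinj
    apply hφ
    simp only [Function.Injective, not_forall] at hinj
    obtain ⟨i, j, hij, hne⟩ := hinj
    exact Matrix.det_zero_of_row_eq hne (by ext l; simp [hij])
  rw [h1, Finset.mul_sum, ← Finset.sum_fiberwise_of_maps_to (t := Finset.univ.powersetCard k)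
    (g := fun φ : Fin k → ι => Finset.univ.image φ)]
  · refine Finset.sum_congr rfl fun S hS => ?_
    have hcard : S.card = k := (Finset.mem_powersetCard.1 hS).2
    have h2 : ∑ φ ∈ (Finset.univ.filter fun φ : Fin k → ι => Function.Injective φ) with
        Finset.univ.image φ = S, (X.submatrix φ φ).det =
        ∑ e : Fin k ≃ S, (X.submatrix (Subtype.val : S → ι) (Subtype.val : S → ι)).det := by
      symm
      refine Finset.sum_bij (fun e _ => Subtype.val ∘ e) ?_ ?_ ?_ ?_
      · intro e _
        simp only [Finset.mem_filter, Finset.mem_univ, true_and]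
        refine ⟨Subtype.val_injective.comp e.injective, ?_⟩
        ext i
        simp only [Finset.mem_image, Finset.mem_univ, true_and, Function.comp_apply]
        constructor
        · rintro ⟨a, rfl⟩
          exact (e a).2
        · intro hi
          exact ⟨e.symm ⟨i, hi⟩, by simp⟩
      · intro e _ e' _ h
        ext i
        exact congrFun h i
      · intro φ hφ
        simp only [Finset.mem_filter, Finset.mem_univ, true_and] at hφ
        obtain ⟨hinj, him⟩ := hφ
        have hmem : ∀ i, φ i ∈ S := fun i => him ▸ Finset.mem_image_of_mem _ (Finset.mem_univ i)
        refine ⟨Equiv.ofBijective (fun i => ⟨φ i, hmem i⟩) ⟨?_, ?_⟩, Finset.mem_univ _, ?_⟩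
        · intro i j hij
          exact hinj (congrArg Subtype.val hij)
        · rintro ⟨s, hs⟩
          rw [← him] at hs
          obtain ⟨i, -, hi⟩ := Finset.mem_image.1 hs
          exact ⟨i, Subtype.ext hi⟩
        · rfl
      · intro e _
        rw [← Matrix.det_submatrix_equiv_self e, Matrix.submatrix_submatrix]
    have hk : Fintype.card (Fin k ≃ S) = k.factorial := by
      rw [Fintype.card_equiv (Fintype.equivOfCardEq (by simp [hcard]))]
      simp
    rw [h2, Finset.sum_const, Finset.card_univ, hk, nsmul_eq_mul]
  · intro φ hφ
    simp only [Finset.mem_filter, Finset.mem_univ, true_and] at hφ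
    rw [Finset.mem_powersetCard]
    exact ⟨Finset.subset_univ _, by rw [Finset.card_image_of_injective _ hφ]; simp⟩

theorem det_one_add_eq_sum_minors (X : Matrix ι ι ℂ) :
    (1 + X).det = ∑ k ∈ Finset.range (Fintype.card ι + 1), ∑ S ∈ Finset.univ.powersetCard k,
        (X.submatrix (Subtype.val : S → ι) (Subtype.val : S → ι)).det := by
  have h : (1 + X).det = ∑ S : Finset ι,
      (X.submatrix (Subtype.val : S → ι) (Subtype.val : S → ι)).det := by
    rw [add_comm]
    change Matrix.detRowAlternating ((fun i => X i) + (fun i => (1 : Matrix ι ι ℂ) i)) = _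
    rw [AlternatingMap.map_add_univ]
    exact Finset.sum_congr rfl fun S _ => Matrix.det_piecewise_one_eq_submatrix_det X S
  rw [h, ← Finset.powerset_univ, Finset.sum_powerset]
  simp [Finset.card_univ]

omit [DecidableEq ι] in
/-- Andréief's identity. -/
theorem integral_det_finite_rank {S : Set ℝ} {F h : ι → ℝ → ℂ}
    (hint : ∀ i l, IntegrableOn (fun x => h i x * F l x) S) (k : ℕ) :
    ∫ x in Set.pi Set.univ (fun _ : Fin k => S),
      (Matrix.of fun i j => ∑ l, F l (x i) * h l (x j)).det =
    ∑ φ : Fin k → ι,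
      ((Matrix.of fun i l => ∫ x in S, h i x * F l x).submatrix φ φ).det := by
  have hexp : ∀ x : Fin k → ℝ, (Matrix.of fun i j => ∑ l, F l (x i) * h l (x j)).det =
      ∑ σ : Equiv.Perm (Fin k), ∑ φ : Fin k → ι, ((Equiv.Perm.sign σ : ℤ) : ℂ) *
        ∏ i, (fun y => h (φ i) y * F (φ (σ⁻¹ i)) y) (x i) := by
    intro x
    rw [Matrix.det_apply']
    refine Finset.sum_congr rfl fun σ _ => ?_
    simp only [Matrix.of_apply]
    rw [Finset.prod_univ_sum, Fintype.piFinset_univ, Finset.mul_sum]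
    refine Finset.sum_congr rfl fun φ _ => ?_
    congr 1
    rw [Finset.prod_mul_distrib, Finset.prod_mul_distrib, mul_comm]
    congr 1
    rw [← Equiv.prod_comp σ (fun i => F (φ (σ⁻¹ i)) (x i))]
    simp
  simp_rw [hexp]
  rw [volume_pi, Measure.restrict_pi_pi]
  have hI : ∀ (σ : Equiv.Perm (Fin k)) (φ : Fin k → ι),
      Integrable (fun x : Fin k → ℝ => ((Equiv.Perm.sign σ : ℤ) : ℂ) *
        ∏ i, (fun y => h (φ i) y * F (φ (σ⁻¹ i)) y) (x i))
        (Measure.pi fun _ : Fin k => volume.restrict S) := by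
    intro σ φ
    apply Integrable.const_mul
    exact Integrable.fintype_prod (f := fun i y => h (φ i) y * F (φ (σ⁻¹ i)) y)
      fun i => hint _ _
  rw [integral_finsetSum _ fun σ _ => integrable_finsetSum _ fun φ _ => hI σ φ]
  simp_rw [integral_finsetSum _ fun φ _ => hI _ φ, integral_const_mul]
  rw [Finset.sum_comm]
  refine Finset.sum_congr rfl fun φ _ => ?_
  rw [Matrix.det_apply']
  refine Finset.sum_congr rfl fun σ _ => ?_
  congr 1
  rw [integral_fintype_prod_eq_prod (fun i y => h (φ i) y * F (φ (σ⁻¹ i)) y),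
    ← Equiv.prod_comp σ]
  simp

/-- The Fredholm determinant of a kernel `∑ l, F l x * h l y` of finite rank is an ordinary
determinant. The Fredholm expansion of the former is the expansion of the latter in principal
minors, by Andréief's identity. -/
theorem fredholmDet_finite_rank {S : Set ℝ} {F h : ι → ℝ → ℂ}
    (hint : ∀ i l, IntegrableOn (fun x => h i x * F l x) S) :
    fredholmDet S (fun x y => ∑ l, F l x * h l y) =
      (1 + Matrix.of fun i l => ∫ x in S, h i x * F l x).det := by
  have hterm : ∀ k : ℕ, (1 / (k.factorial : ℂ)) *
      ∫ x in Set.pi Set.univ (fun _ : Fin k => S),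
        (Matrix.of fun i j => ∑ l, F l (x i) * h l (x j)).det =
      ∑ T ∈ Finset.univ.powersetCard k, ((Matrix.of fun i l => ∫ x in S, h i x * F l x).submatrix
        (Subtype.val : T → ι) (Subtype.val : T → ι)).det := by
    intro k
    have hk : (k.factorial : ℂ) ≠ 0 := Nat.cast_ne_zero.2 k.factorial_ne_zero
    rw [integral_det_finite_rank hint, sum_det_submatrix, ← mul_assoc, one_div,
      inv_mul_cancel₀ hk, one_mul]
  unfold fredholmDet
  simp_rw [hterm]
  rw [det_one_add_eq_sum_minors, tsum_eq_sum]
  intro k hk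
  rw [Finset.powersetCard_eq_empty.2, Finset.sum_empty]
  simpa [Finset.card_univ] using hk

end Fredholm

/-! ### Residues of functions with simple poles along a contour in a half plane -/

section Residues

variable {κ ι : Type*} {γ : ℝ → ℂ} {U : Set ℂ} {p : κ → ℂ}

theorem IsContour.intervalIntegrable (hγ : IsContour γ U p) {f : ℂ → ℂ}
    (hf : ContinuousOn (fun τ => f (γ τ)) (Set.Icc 0 1)) :
    IntervalIntegrable (fun τ => f (γ τ) * deriv γ τ) volume 0 1 := by
  obtain ⟨S, M, hS⟩ := hγ.piecewise_C1
  have h1 : IntervalIntegrable (deriv γ) volume 0 1 := by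
    rw [intervalIntegrable_iff_integrableOn_Ioo_of_le zero_le_one]
    refine Measure.integrableOn_of_bounded (M := M) (by simp)
      (measurable_deriv γ).aestronglyMeasurable ?_
    rw [ae_restrict_iff' measurableSet_Ioo]
    have h0 : ∀ᵐ τ : ℝ, τ ∉ (S : Set ℝ) :=
      (Set.Countable.ae_notMem S.countable_toSet volume)
    filter_upwards [h0] with τ h2 h3
    exact (hS τ h3 h2).2.2
  exact h1.continuousOn_mul (by rwa [Set.uIcc_of_le zero_le_one])

theorem contourIntegral_congr {f g : ℂ → ℂ} (h : ∀ τ ∈ Set.Icc (0 : ℝ) 1, f (γ τ) = g (γ τ)) :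
    contourIntegral γ f = contourIntegral γ g := by
  unfold contourIntegral
  refine intervalIntegral.integral_congr fun τ hτ => ?_
  rw [Set.uIcc_of_le zero_le_one] at hτ
  simp only [h τ hτ]

theorem contourIntegral_const_mul (c : ℂ) (f : ℂ → ℂ) :
    contourIntegral γ (fun z => c * f z) = c * contourIntegral γ f := by
  unfold contourIntegral
  rw [← intervalIntegral.integral_const_mul]
  simp only [mul_assoc]

theorem IsContour.contourIntegral_add (hγ : IsContour γ U p) {f g : ℂ → ℂ}
    (hf : ContinuousOn (fun τ => f (γ τ)) (Set.Icc 0 1))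
    (hg : ContinuousOn (fun τ => g (γ τ)) (Set.Icc 0 1)) :
    contourIntegral γ (fun z => f z + g z) = contourIntegral γ f + contourIntegral γ g := by
  unfold contourIntegral
  rw [← intervalIntegral.integral_add (hγ.intervalIntegrable hf) (hγ.intervalIntegrable hg)]
  simp only [add_mul]

theorem IsContour.contourIntegral_sum (hγ : IsContour γ U p) (s : Finset ι) {f : ι → ℂ → ℂ}
    (hf : ∀ i ∈ s, ContinuousOn (fun τ => f i (γ τ)) (Set.Icc 0 1)) :
    contourIntegral γ (fun z => ∑ i ∈ s, f i z) = ∑ i ∈ s, contourIntegral γ (f i) := by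
  unfold contourIntegral
  rw [← intervalIntegral.integral_finsetSum fun i hi => hγ.intervalIntegrable (hf i hi)]
  simp only [Finset.sum_mul]

/-- The half plane `Re z < 0` for `ε = 1`, and `Re z > 0` for `ε = -1`. -/
def halfPlane (ε : ℝ) : Set ℂ := {z | ε * z.re < 0}

theorem isOpen_halfPlane (ε : ℝ) : IsOpen (halfPlane ε) :=
  isOpen_lt (by fun_prop) continuous_const

/-- Cauchy's theorem in a half plane: the contour lies in a disk in the half plane, and there the
integrand has a primitive. -/
theorem IsContour.integral_eq_zero {ε : ℝ} (hε : ε ^ 2 = 1)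
    (hγ : IsContour γ (halfPlane ε) p) {f : ℂ → ℂ} (hf : DifferentiableOn ℂ f (halfPlane ε)) :
    contourIntegral γ f = 0 := by
  -- The disk of radius `r` about `-ε r` consists of the `z` with `‖z‖ ^ 2 < -2 r ε Re z`, and so it
  -- contains the compact curve once `r` is large.
  have hneg : ∀ τ ∈ Set.Icc (0 : ℝ) 1, ε * (γ τ).re < 0 := fun τ hτ => hγ.mapsTo hτ
  have hcont : ContinuousOn (fun τ => ‖γ τ‖ ^ 2 / (-2 * (ε * (γ τ).re))) (Set.Icc 0 1) := by
    refine ContinuousOn.div (hγ.continuousOn.norm.pow 2) ?_ ?_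
    · exact continuousOn_const.mul
        (continuousOn_const.mul (Complex.continuous_re.comp_continuousOn hγ.continuousOn))
    · intro τ hτ
      have := hneg τ hτ
      nlinarith
  obtain ⟨M, hM⟩ := (isCompact_Icc.bddAbove_image hcont)
  set r : ℝ := |M| + 1 with hr
  have hrpos : 0 < r := by positivity
  have hball : ∀ z : ℂ, z ∈ Metric.ball (((-ε * r : ℝ)) : ℂ) r ↔
      ‖z‖ ^ 2 < r * (-2 * (ε * z.re)) := by
    intro z
    rw [Metric.mem_ball, dist_eq_norm, ← sq_lt_sq₀ (norm_nonneg _) hrpos.le, Complex.sq_norm,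
      Complex.sq_norm, Complex.normSq_apply, Complex.normSq_apply]
    simp only [Complex.sub_re, Complex.sub_im, Complex.ofReal_re, Complex.ofReal_im]
    have : (z.re - -ε * r) * (z.re - -ε * r) = z.re * z.re + 2 * (ε * z.re) * r + r ^ 2 := by
      linear_combination r ^ 2 * hε
    rw [this]
    constructor <;> intro h <;> nlinarith
  have hmem : ∀ τ ∈ Set.Icc (0 : ℝ) 1, γ τ ∈ Metric.ball (((-ε * r : ℝ)) : ℂ) r := by
    intro τ hτ
    rw [hball]
    have h1 := hneg τ hτ
    have h2 : ‖γ τ‖ ^ 2 / (-2 * (ε * (γ τ).re)) < r :=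
      lt_of_le_of_lt (hM ⟨τ, hτ, rfl⟩) (by rw [hr]; linarith [le_abs_self M])
    rwa [div_lt_iff₀ (by linarith)] at h2
  have hsub : Metric.ball (((-ε * r : ℝ)) : ℂ) r ⊆ halfPlane ε := by
    intro z hz
    rw [hball] at hz
    have h3 : 0 < r * (-2 * (ε * z.re)) := lt_of_le_of_lt (sq_nonneg _) hz
    have := (pos_iff_pos_of_mul_pos h3).1 hrpos
    change ε * z.re < 0
    linarith
  obtain ⟨F, hF⟩ := (hf.mono hsub).isExactOn_ball
  obtain ⟨S, B, hS⟩ := hγ.piecewise_C1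
  have hFTC : ∫ τ in (0 : ℝ)..1, f (γ τ) * deriv γ τ = F (γ 1) - F (γ 0) := by
    refine integral_eq_of_hasDerivAt_off_countable (fun τ => F (γ τ)) _ S.countable_toSet
      ?_ ?_ ?_
    · rw [Set.uIcc_of_le zero_le_one]
      intro τ hτ
      exact (hF _ (hmem τ hτ)).continuousAt.comp_continuousWithinAt (hγ.continuousOn τ hτ)
    · rw [min_eq_left zero_le_one, max_eq_right zero_le_one]
      rintro τ ⟨hτ, hτS⟩
      exact (hF _ (hmem τ (Set.Ioo_subset_Icc_self hτ))).comp τ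
        (hS τ hτ hτS).1.hasDerivAt
    · exact hγ.intervalIntegrable (hf.continuousOn.comp hγ.continuousOn hγ.mapsTo)
  unfold contourIntegral
  rw [hFTC, hγ.closed, sub_self]

theorem IsContour.continuousOn_inv (hγ : IsContour γ U p) (j : κ) :
    ContinuousOn (fun τ => (γ τ - p j)⁻¹) (Set.Icc 0 1) :=
  (hγ.continuousOn.sub continuousOn_const).inv₀ fun τ hτ => sub_ne_zero.2 (hγ.avoids j τ hτ)

/-- Splitting off the pole leaves the holomorphic function `dslope f (p j)`. -/
theorem IsContour.integral_mul_inv {ε : ℝ} (hε : ε ^ 2 = 1)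
    (hγ : IsContour γ (halfPlane ε) p) {f : ℂ → ℂ} (hf : DifferentiableOn ℂ f (halfPlane ε))
    {j : κ} (hj : p j ∈ halfPlane ε) :
    contourIntegral γ (fun z => f z * (z - p j)⁻¹) = 2 * (Real.pi : ℂ) * Complex.I * f (p j) := by
  have hd : DifferentiableOn ℂ (dslope f (p j)) (halfPlane ε) :=
    (Complex.differentiableOn_dslope ((isOpen_halfPlane ε).mem_nhds hj)).2 hf
  have h1 : contourIntegral γ (fun z => f z * (z - p j)⁻¹) =
      contourIntegral γ (fun z => f (p j) * (z - p j)⁻¹ + dslope f (p j) z) := by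
    refine contourIntegral_congr fun τ hτ => ?_
    have hne := hγ.avoids j τ hτ
    rw [dslope_of_ne _ hne, slope_def_field, div_eq_mul_inv]
    ring
  rw [h1, hγ.contourIntegral_add (f := fun z => f (p j) * (z - p j)⁻¹)
    (continuousOn_const.mul (hγ.continuousOn_inv j))
    (hd.continuousOn.comp hγ.continuousOn hγ.mapsTo), contourIntegral_const_mul, hγ.winding,
    hγ.integral_eq_zero hε hd]
  ring

variable [Fintype ι] [DecidableEq ι]

/-- The polynomial `∏ j, (1 - z / p j)`, as a function. -/
noncomputable def rootProd (p : ι → ℂ) (z : ℂ) : ℂ := ∏ j, (1 - z / p j)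

/-- The residue of `1 / rootProd p` at `p j`. -/
noncomputable def resWeight (p : ι → ℂ) (j : ι) : ℂ := Lagrange.nodalWeight Finset.univ p j * ∏ i, -p i

/-- The Lagrange basis polynomial, with value `1` at `p j` and `0` at the other nodes. -/
noncomputable def lagrangeBasis (p : ι → ℂ) (j : ι) : Polynomial ℂ := Lagrange.basis Finset.univ p j

variable {p : ι → ℂ}

omit [DecidableEq ι] in
theorem eval_nodal_eq (hp0 : ∀ j, p j ≠ 0) (z : ℂ) :
    (Lagrange.nodal Finset.univ p).eval z = (∏ i, -p i) * rootProd p z := by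
  rw [Lagrange.eval_nodal, rootProd, ← Finset.prod_mul_distrib]
  refine Finset.prod_congr rfl fun j _ => ?_
  field_simp [hp0 j]
  ring

omit [DecidableEq ι] in
theorem prod_neg_ne_zero (hp0 : ∀ j, p j ≠ 0) : ∏ i, -p i ≠ 0 :=
  Finset.prod_ne_zero_iff.2 fun i _ => neg_ne_zero.2 (hp0 i)

theorem resWeight_ne_zero (hp : Function.Injective p) (hp0 : ∀ j, p j ≠ 0) (j : ι) :
    resWeight p j ≠ 0 :=
  mul_ne_zero (Lagrange.nodalWeight_ne_zero hp.injOn (Finset.mem_univ j)) (prod_neg_ne_zero hp0)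

omit [DecidableEq ι] in
theorem rootProd_self (hp0 : ∀ j, p j ≠ 0) (j : ι) : rootProd p (p j) = 0 :=
  Finset.prod_eq_zero (Finset.mem_univ j) (by rw [div_self (hp0 j), sub_self])

omit [DecidableEq ι] in
theorem differentiable_rootProd (p : ι → ℂ) : Differentiable ℂ (rootProd p) := by
  unfold rootProd
  fun_prop

theorem resWeight_mul_rootProd (hp0 : ∀ j, p j ≠ 0) (j : ι) (w : ℂ) :
    resWeight p j * rootProd p w = (lagrangeBasis p j).eval w * (w - p j) := by
  by_cases h : w = p j
  · rw [h, rootProd_self hp0, sub_self, mul_zero, mul_zero]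
  · rw [lagrangeBasis, Lagrange.eval_basis_not_at_node (Finset.mem_univ j) h, eval_nodal_eq hp0,
      resWeight]
    field_simp [sub_ne_zero.2 h]

/-- The partial fraction expansion of `1 / rootProd p`. -/
theorem inv_rootProd [Nonempty ι] (hp : Function.Injective p) (hp0 : ∀ j, p j ≠ 0) {z : ℂ}
    (hz : ∀ j, z ≠ p j) : (rootProd p z)⁻¹ = ∑ j, resWeight p j * (z - p j)⁻¹ := by
  have h := Lagrange.eval_interpolate_not_at_node (s := Finset.univ) (v := p) (1 : ι → ℂ)
    (fun i _ => hz i)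
  rw [Lagrange.interpolate_one hp.injOn Finset.univ_nonempty, Polynomial.eval_one,
    eval_nodal_eq hp0] at h
  refine inv_eq_of_mul_eq_one_right ?_
  rw [h]
  simp only [Pi.one_apply, mul_one, resWeight, Finset.mul_sum]
  exact Finset.sum_congr rfl fun j _ => by ring

/-- The residue theorem for the simple poles `p j` of `1 / rootProd p`. -/
theorem IsContour.integral_mul_inv_rootProd {ε : ℝ} (hε : ε ^ 2 = 1)
    (hγ : IsContour γ (halfPlane ε) p) (hp : Function.Injective p)
    (hpU : ∀ j, p j ∈ halfPlane ε)
    {f : ℂ → ℂ} (hf : DifferentiableOn ℂ f (halfPlane ε)) :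
    contourIntegral γ (fun z => f z * (rootProd p z)⁻¹) =
      2 * (Real.pi : ℂ) * Complex.I * ∑ j, resWeight p j * f (p j) := by
  have hp0 : ∀ j, p j ≠ 0 := by
    intro j hj
    have := hpU j
    rw [hj] at this
    simp [halfPlane] at this
  -- The partial fraction expansion of `1` fails for the empty product.
  rcases isEmpty_or_nonempty ι with hι | hι
  · simp only [rootProd, Finset.univ_eq_empty, Finset.prod_empty, inv_one, mul_one,
      Finset.sum_empty, mul_zero]
    exact hγ.integral_eq_zero hε hf
  · have h1 : contourIntegral γ (fun z => f z * (rootProd p z)⁻¹) =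
        contourIntegral γ (fun z => ∑ j, resWeight p j * (f z * (z - p j)⁻¹)) := by
      refine contourIntegral_congr fun τ hτ => ?_
      rw [inv_rootProd hp hp0 fun j => hγ.avoids j τ hτ, Finset.mul_sum]
      exact Finset.sum_congr rfl fun j _ => by ring
    rw [h1, hγ.contourIntegral_sum (f := fun j z => resWeight p j * (f z * (z - p j)⁻¹)) _
      fun j _ => continuousOn_const.mul
      ((hf.continuousOn.comp hγ.continuousOn hγ.mapsTo).mul (hγ.continuousOn_inv j)),
      Finset.mul_sum]
    refine Finset.sum_congr rfl fun j _ => ?_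
    rw [contourIntegral_const_mul, hγ.integral_mul_inv hε hf (hpU j)]
    ring

end Residues

/-! ### Real zeros of exponential sums and exponential polynomials -/

section Zeros

/-- Rolle's theorem for several zeros. -/
theorem exists_strictMono_deriv_zeros {f f' : ℝ → ℝ} (hf : ∀ x, HasDerivAt f (f' x) x) {k : ℕ}
    {z : Fin (k + 1) → ℝ} (hz : StrictMono z) (h0 : ∀ i, f (z i) = 0) :
    ∃ w : Fin k → ℝ, StrictMono w ∧ ∀ i, f' (w i) = 0 := by
  have h : ∀ i : Fin k, ∃ c ∈ Set.Ioo (z i.castSucc) (z i.succ), f' c = 0 := fun i =>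
    exists_hasDerivAt_eq_zero (hz i.castSucc_lt_succ)
      (fun x _ => (hf x).continuousAt.continuousWithinAt) (by rw [h0, h0]) fun x _ => hf x
  choose w hw hw0 using h
  refine ⟨w, fun i j hij => ?_, hw0⟩
  have : z i.succ ≤ z j.castSucc := hz.monotone (by
    rw [Fin.le_iff_val_le_val]
    simpa using Nat.succ_le_of_lt (Fin.lt_def.1 hij))
  exact ((hw i).2.trans_le this).trans (hw j).1

/-- A sum of `k` exponentials with `k` distinct real zeros vanishes identically. -/
theorem expSum_coeff_eq_zero {ι : Type*} [DecidableEq ι] (s : Finset ι) {k : ℕ} (hk : k = s.card)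
    {μ : ι → ℝ} (hμ : Function.Injective μ) {c : ι → ℝ} {z : Fin k → ℝ} (hz : StrictMono z)
    (h0 : ∀ i, ∑ j ∈ s, c j * Real.exp (μ j * z i) = 0) : ∀ j ∈ s, c j = 0 := by
  suffices H : ∀ (s : Finset ι) (k : ℕ) (_ : k = s.card) (μ : ι → ℝ) (_ : Function.Injective μ)
      (c : ι → ℝ) (z : Fin k → ℝ) (_ : StrictMono z)
      (_ : ∀ i, ∑ j ∈ s, c j * Real.exp (μ j * z i) = 0), ∀ j ∈ s, c j = 0 from
    H s _ hk μ hμ c z hz h0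
  intro s
  induction s using Finset.induction_on with
  | empty => simp
  | insert j₀ s hj₀ ih =>
    intro k hk μ hμ c z hz h0
    rw [Finset.card_insert_of_notMem hj₀] at hk
    subst hk
    -- After division by `exp (μ j₀ x)`, differentiation removes the term `j₀`.
    have hder : ∀ x, HasDerivAt (fun x => c j₀ + ∑ j ∈ s, c j * Real.exp ((μ j - μ j₀) * x))
        (∑ j ∈ s, (c j * (μ j - μ j₀)) * Real.exp ((μ j - μ j₀) * x)) x := by
      intro x
      refine (HasDerivAt.fun_sum fun j _ => ?_).const_add _
      convert! (((hasDerivAt_id x).const_mul (μ j - μ j₀)).exp).const_mul (c j) using 1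
      simp only [id, mul_one]
      ring
    have hzero : ∀ i, c j₀ + ∑ j ∈ s, c j * Real.exp ((μ j - μ j₀) * z i) = 0 := by
      intro i
      have h := h0 i
      rw [Finset.sum_insert hj₀] at h
      have h2 : (c j₀ + ∑ j ∈ s, c j * Real.exp ((μ j - μ j₀) * z i)) =
          Real.exp (-(μ j₀ * z i)) *
            (c j₀ * Real.exp (μ j₀ * z i) + ∑ j ∈ s, c j * Real.exp (μ j * z i)) := by
        rw [mul_add, Finset.mul_sum]
        congr 1
        · rw [mul_left_comm, ← Real.exp_add, neg_add_cancel, Real.exp_zero, mul_one]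
        · refine Finset.sum_congr rfl fun j _ => ?_
          rw [mul_left_comm, ← Real.exp_add]
          congr 2
          ring
      rw [h2, h, mul_zero]
    obtain ⟨w, hw, hw0⟩ := exists_strictMono_deriv_zeros hder hz hzero
    have hs := ih _ rfl (fun j => μ j - μ j₀) (fun i j hij => hμ (by simpa using hij)) _ w hw hw0
    have hs' : ∀ j ∈ s, c j = 0 := by
      intro j hj
      rcases mul_eq_zero.1 (hs j hj) with h | h
      · exact h
      · exact absurd (hμ (sub_eq_zero.1 h)) fun h => hj₀ (h ▸ hj)
    have h₀ : c j₀ = 0 := by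
      have h := hzero 0
      rwa [Finset.sum_eq_zero fun j hj => by rw [hs' j hj, zero_mul], add_zero] at h
    intro j hj
    rcases Finset.mem_insert.1 hj with rfl | hj
    · exact h₀
    · exact hs' j hj

/-- If `P + exp (a x) Q` with `deg P < n` and `deg Q < m` has `n + m` distinct real zeros, then
`P = Q = 0`. -/
theorem expPoly_eq_zero_real {a : ℝ} (ha : a ≠ 0) {m : ℕ} (n : ℕ) :
    ∀ (k : ℕ) (_ : k = n + m) (P Q : Polynomial ℝ) (_ : P.degree < n) (_ : Q.degree < m)
      (z : Fin k → ℝ) (_ : StrictMono z)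
      (_ : ∀ i, P.eval (z i) + Real.exp (a * z i) * Q.eval (z i) = 0), P = 0 ∧ Q = 0 := by
  induction n with
  | zero =>
    intro k hk P Q hP hQ z hz h0
    have hP0 : P = 0 := by
      rw [Nat.cast_zero] at hP
      exact Polynomial.degree_eq_bot.1 (Nat.WithBot.lt_zero_iff.1 hP)
    refine ⟨hP0, ?_⟩
    refine Polynomial.eq_zero_of_degree_lt_of_eval_index_eq_zero (v := z) Finset.univ
      hz.injective.injOn ?_ fun i _ => ?_
    · simpa [hk] using hQ
    · have := h0 i
      rw [hP0, Polynomial.eval_zero, zero_add] at this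
      exact (mul_eq_zero.1 this).resolve_left (Real.exp_pos _).ne'
  | succ n ih =>
    intro k hk P Q hP hQ z hz h0
    obtain rfl : k = (n + m) + 1 := by omega
    -- Differentiation lowers the degree of `P` and does not raise that of the other factor.
    have hder : ∀ x, HasDerivAt (fun x => P.eval x + Real.exp (a * x) * Q.eval x)
        ((Polynomial.derivative P).eval x + Real.exp (a * x) *
          (Polynomial.C a * Q + Polynomial.derivative Q).eval x) x := by
      intro x
      have h1 : HasDerivAt (fun x => Real.exp (a * x)) (Real.exp (a * x) * a) x := by
        simpa using ((hasDerivAt_id x).const_mul a).exp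
      convert! (P.hasDerivAt x).add (h1.mul (Q.hasDerivAt x)) using 1
      simp only [Polynomial.eval_add, Polynomial.eval_mul, Polynomial.eval_C]
      ring
    obtain ⟨w, hw, hw0⟩ := exists_strictMono_deriv_zeros hder hz h0
    rw [Polynomial.degree_lt_iff_coeff_zero] at hP hQ
    obtain ⟨hP', hQ'⟩ := ih _ rfl (Polynomial.derivative P)
      (Polynomial.C a * Q + Polynomial.derivative Q)
      (by
        rw [Polynomial.degree_lt_iff_coeff_zero]
        intro j hj
        rw [Polynomial.coeff_derivative, hP (j + 1) (by omega), zero_mul])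
      (by
        rw [Polynomial.degree_lt_iff_coeff_zero]
        intro j hj
        rw [Polynomial.coeff_add, Polynomial.coeff_C_mul, Polynomial.coeff_derivative, hQ j hj,
          hQ (j + 1) (by omega), mul_zero, zero_mul, add_zero]) w hw hw0
    have hQ0 : Q = 0 := by
      have h := congrArg (fun q => Polynomial.coeff q Q.natDegree) hQ'
      simp only [Polynomial.coeff_add, Polynomial.coeff_C_mul, Polynomial.coeff_derivative,
        Polynomial.coeff_zero,
        Polynomial.coeff_eq_zero_of_natDegree_lt (Nat.lt_succ_self Q.natDegree), zero_mul,
        add_zero] at h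
      exact Polynomial.leadingCoeff_eq_zero.1 ((mul_eq_zero.1 h).resolve_left ha)
    refine ⟨?_, hQ0⟩
    have h1 := Polynomial.eq_C_of_natDegree_eq_zero
      (Polynomial.derivative_eq_zero.1 hP')
    have h2 := h0 0
    rw [hQ0, Polynomial.eval_zero, mul_zero, add_zero, h1, Polynomial.eval_C] at h2
    rw [h1, h2, Polynomial.C_0]

/-- Splits a complex polynomial, on the real axis, into its real and imaginary part. -/
theorem exists_re_im_polynomial {n : ℕ} {P : Polynomial ℂ} (hP : P.degree < n) :
    ∃ Pr Pi : Polynomial ℝ, Pr.degree < n ∧ Pi.degree < n ∧ (Pr = 0 → Pi = 0 → P = 0) ∧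
      ∀ x : ℝ, (P.eval (x : ℂ)).re = Pr.eval x ∧ (P.eval (x : ℂ)).im = Pi.eval x := by
  have key : ∀ φ : ℂ →ₗ[ℝ] ℝ, ∃ R : Polynomial ℝ, R.degree < n ∧
      (∀ i < n, R.coeff i = φ (P.coeff i)) ∧ ∀ x : ℝ, φ (P.eval (x : ℂ)) = R.eval x := by
    intro φ
    refine ⟨∑ i ∈ Finset.range n, Polynomial.monomial i (φ (P.coeff i)), ?_, ?_, ?_⟩
    · rw [Polynomial.degree_lt_iff_coeff_zero]
      intro j hj
      rw [Polynomial.finsetSum_coeff]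
      refine Finset.sum_eq_zero fun i hi => Polynomial.coeff_monomial_of_ne _ ?_
      have := Finset.mem_range.1 hi
      omega
    · intro j hj
      rw [Polynomial.finsetSum_coeff]
      simp [Polynomial.coeff_monomial, hj]
    · intro x
      rw [Polynomial.eval_finsetSum]
      have h : P.eval (x : ℂ) = ∑ i ∈ Finset.range n, (x ^ i : ℝ) • P.coeff i := by
        by_cases h0 : P = 0
        · simp [h0]
        · rw [Polynomial.eval_eq_sum_range' ((Polynomial.natDegree_lt_iff_degree_lt h0).2 hP)]
          refine Finset.sum_congr rfl fun i _ => ?_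
          rw [Complex.real_smul]
          push_cast
          ring
      rw [h, map_sum]
      refine Finset.sum_congr rfl fun i _ => ?_
      rw [map_smul, Polynomial.eval_monomial, smul_eq_mul, mul_comm]
  obtain ⟨Pr, h1, h2, h3⟩ := key Complex.reLm
  obtain ⟨Pi, h4, h5, h6⟩ := key Complex.imLm
  refine ⟨Pr, Pi, h1, h4, fun hr hi => ?_, fun x => ⟨h3 x, h6 x⟩⟩
  ext j
  by_cases hj : j < n
  · have h7 := h2 j hj
    have h8 := h5 j hj
    rw [hr, Polynomial.coeff_zero] at h7
    rw [hi, Polynomial.coeff_zero] at h8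
    exact Complex.ext h7.symm h8.symm
  · rw [(Polynomial.degree_lt_iff_coeff_zero _ _).1 hP j (not_lt.1 hj), Polynomial.coeff_zero]

/-- The complex form of `expPoly_eq_zero_real`, with the zeros indexed by a finite type. -/
theorem expPoly_eq_zero {a : ℝ} (ha : a ≠ 0) {n m : ℕ} {σ : Type*} [Fintype σ]
    (hcard : Fintype.card σ = n + m) {z : σ → ℝ} (hz : Function.Injective z)
    {P Q : Polynomial ℂ} (hP : P.degree < n) (hQ : Q.degree < m)
    (h0 : ∀ i, P.eval (z i : ℂ) + Complex.exp (a * z i) * Q.eval (z i : ℂ) = 0) :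
    P = 0 ∧ Q = 0 := by
  classical
  have hc : (Finset.univ.image z).card = n + m := by
    rw [Finset.card_image_of_injective _ hz, Finset.card_univ, hcard]
  set y := (Finset.univ.image z).orderEmbOfFin hc with hy
  obtain ⟨Pr, Pi, hPr, hPi, hP0, hPe⟩ := exists_re_im_polynomial hP
  obtain ⟨Qr, Qi, hQr, hQi, hQ0, hQe⟩ := exists_re_im_polynomial hQ
  have hzero : ∀ i, P.eval (y i : ℂ) + Complex.exp (a * y i) * Q.eval (y i : ℂ) = 0 := by
    intro i
    obtain ⟨j, -, hj⟩ := Finset.mem_image.1 (Finset.orderEmbOfFin_mem _ hc i)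
    rw [hy, ← hj]
    exact h0 j
  have hexp : ∀ x : ℝ, Complex.exp (a * x) = ((Real.exp (a * x) : ℝ) : ℂ) := by
    intro x
    push_cast
    rfl
  obtain ⟨h1, h2⟩ := expPoly_eq_zero_real ha n _ rfl Pr Qr hPr hQr y y.strictMono fun i => by
    have := congrArg Complex.re (hzero i)
    rw [hexp, Complex.add_re, Complex.re_ofReal_mul] at this
    rwa [← (hPe _).1, ← (hQe _).1]
  obtain ⟨h3, h4⟩ := expPoly_eq_zero_real ha n _ rfl Pi Qi hPi hQi y y.strictMono fun i => by
    have := congrArg Complex.im (hzero i)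
    rw [hexp, Complex.add_im, Complex.im_ofReal_mul] at this
    rwa [← (hPe _).2, ← (hQe _).2]
  exact ⟨hP0 h1 h3, hQ0 h2 h4⟩

end Zeros

/-! ### Gaussian moments along vertical lines -/

section Gaussian

variable {t : ℝ}

theorem expW_line (ht : t ∈ Set.Ioo (0 : ℝ) 1) (α v c y : ℝ) :
    expW α t v (c + y * Complex.I) =
      Complex.exp (((-(t / (2 * (1 - t))) : ℝ) : ℂ) * (y : ℂ) ^ 2 +
        ((t / (1 - t) * c + (α - v / (1 - t)) : ℝ) : ℂ) * Complex.I * y +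
        ((t / (2 * (1 - t)) * c ^ 2 + (α - v / (1 - t)) * c : ℝ) : ℂ)) := by
  have h1 : (1 - (t : ℂ)) ≠ 0 := by exact_mod_cast (sub_pos.2 ht.2).ne'
  rw [expW]
  congr 1
  push_cast
  field_simp
  linear_combination ((t : ℂ) * y ^ 2) * Complex.I_sq

theorem norm_expW_line (ht : t ∈ Set.Ioo (0 : ℝ) 1) (α v c y : ℝ) :
    ‖expW α t v (c + y * Complex.I)‖ =
      Real.exp (t / (2 * (1 - t)) * c ^ 2 + (α - v / (1 - t)) * c) *
        Real.exp (-(t / (2 * (1 - t))) * y ^ 2) := by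
  rw [expW_line ht, Complex.norm_exp, ← Real.exp_add]
  congr 1
  simp only [Complex.add_re, ← Complex.ofReal_pow, ← Complex.ofReal_mul, Complex.ofReal_re,
    mul_assoc, Complex.mul_re, Complex.I_re, Complex.I_im,
    Complex.ofReal_im]
  ring

theorem gauss_rate_pos (ht : t ∈ Set.Ioo (0 : ℝ) 1) : 0 < t / (2 * (1 - t)) :=
  div_pos ht.1 (by linarith [ht.2])

theorem continuous_expW (α t v : ℝ) : Continuous (expW α t v) := by
  unfold expW
  fun_prop

theorem integrable_pow_mul_exp_neg_sq {b : ℝ} (hb : 0 < b) (k : ℕ) :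
    Integrable fun y : ℝ => y ^ k * Real.exp (-b * y ^ 2) := by
  have h := integrable_rpow_mul_exp_neg_mul_sq hb (s := k) (by
    have : (0 : ℝ) ≤ k := k.cast_nonneg
    linarith)
  simpa only [Real.rpow_natCast] using h

theorem integrable_expW_mul_eval (ht : t ∈ Set.Ioo (0 : ℝ) 1) (α v c : ℝ) (P : Polynomial ℂ) :
    Integrable fun y : ℝ => expW α t v (c + y * Complex.I) * P.eval (c + y * Complex.I) := by
  set R := P.comp (Polynomial.C (c : ℂ) + Polynomial.X * Polynomial.C Complex.I) with hR
  have hRe : ∀ y : ℝ, P.eval (c + y * Complex.I) =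
      ∑ i ∈ Finset.range (R.natDegree + 1), R.coeff i * (y : ℂ) ^ i := by
    intro y
    rw [← Polynomial.eval_eq_sum_range, hR, Polynomial.eval_comp]
    simp only [Polynomial.eval_add, Polynomial.eval_mul, Polynomial.eval_C, Polynomial.eval_X]
  simp_rw [hRe, Finset.mul_sum]
  refine integrable_finsetSum _ fun i _ => ?_
  have hi := ((integrable_pow_mul_exp_neg_sq (gauss_rate_pos ht) i).norm).const_mul
    (‖R.coeff i‖ * Real.exp (t / (2 * (1 - t)) * c ^ 2 + (α - v / (1 - t)) * c))
  refine hi.mono' ?_ (ae_of_all _ fun y => ?_)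
  · have := continuous_expW α t v
    exact Continuous.aestronglyMeasurable (by fun_prop)
  · rw [norm_mul, norm_expW_line ht, norm_mul, norm_mul, norm_pow, norm_pow, Complex.norm_real,
      Real.norm_of_nonneg (Real.exp_pos (-(t / (2 * (1 - t))) * y ^ 2)).le]
    apply le_of_eq
    ring

theorem integral_expW (ht : t ∈ Set.Ioo (0 : ℝ) 1) (α v c : ℝ) :
    ∫ y : ℝ, expW α t v (c + y * Complex.I) =
      ((Real.sqrt (2 * Real.pi * (1 - t) / t) *
        Real.exp (-((α - v / (1 - t)) ^ 2 * (1 - t) / (2 * t))) : ℝ) : ℂ) := by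
  have h0 : (t : ℂ) ≠ 0 := by exact_mod_cast ht.1.ne'
  have h1 : (1 - (t : ℂ)) ≠ 0 := by exact_mod_cast (sub_pos.2 ht.2).ne'
  simp_rw [expW_line ht]
  rw [integral_cexp_quadratic (by
    rw [Complex.ofReal_re]
    linarith [gauss_rate_pos ht])]
  rw [Complex.ofReal_mul, Complex.ofReal_exp]
  congr 1
  · rw [Real.sqrt_eq_rpow, Complex.ofReal_cpow (by
      have := ht.1
      have := sub_pos.2 ht.2
      positivity)]
    congr 1
    · push_cast
      field_simp
    · push_cast
      rfl
  · congr 1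
    push_cast
    field_simp
    linear_combination (4 * ((t : ℂ) * c + (α * (1 - t) - v)) ^ 2) * Complex.I_sq

theorem hasDerivAt_expW (α t v : ℝ) (w : ℂ) :
    HasDerivAt (expW α t v)
      (expW α t v w * ((t : ℂ) / (1 - t) * w + (α - v / (1 - t)))) w := by
  unfold expW
  have h : HasDerivAt (fun w : ℂ => (t : ℂ) / (2 * (1 - t)) * w ^ 2 + α * w - v * w / (1 - t))
      ((t : ℂ) / (1 - t) * w + (α - v / (1 - t))) w := by
    convert! ((((hasDerivAt_id w).pow 2).const_mul ((t : ℂ) / (2 * (1 - t)))).add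
      ((hasDerivAt_id w).const_mul (α : ℂ))).sub
      (((hasDerivAt_id w).const_mul (v : ℂ)).div_const (1 - (t : ℂ))) using 1
    simp only [id, div_eq_mul_inv, mul_inv]
    push_cast
    ring
  exact h.cexp

/-- Integration by parts for the Gaussian weight along a vertical line. -/
theorem integral_expW_parts (ht : t ∈ Set.Ioo (0 : ℝ) 1) (α v c : ℝ) (P : Polynomial ℂ) :
    ∫ y : ℝ, expW α t v (c + y * Complex.I) *
      ((Polynomial.C ((t : ℂ) / (1 - t)) * Polynomial.X + Polynomial.C (α - v / (1 - t) : ℂ)) * P +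
        Polynomial.derivative P).eval (c + y * Complex.I) = 0 := by
  set R := (Polynomial.C ((t : ℂ) / (1 - t)) * Polynomial.X +
    Polynomial.C (α - v / (1 - t) : ℂ)) * P + Polynomial.derivative P with hR
  have hd : ∀ y : ℝ, HasDerivAt
      (fun y : ℝ => expW α t v (c + y * Complex.I) * P.eval (c + y * Complex.I))
      (Complex.I * (expW α t v (c + y * Complex.I) * R.eval (c + y * Complex.I))) y := by
    intro y
    have hl : HasDerivAt (fun y : ℝ => (c : ℂ) + y * Complex.I) Complex.I y := by
      simpa using ((Complex.ofRealCLM.hasDerivAt (x := y)).mul_const Complex.I).const_add (c : ℂ)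
    have := ((hasDerivAt_expW α t v (c + y * Complex.I)).mul
      (P.hasDerivAt (c + y * Complex.I))).comp y hl
    convert! this using 1
    simp only [hR, Polynomial.eval_add, Polynomial.eval_mul, Polynomial.eval_C, Polynomial.eval_X]
    ring
  have h := integral_eq_zero_of_hasDerivAt_of_integrable hd
    ((integrable_expW_mul_eval ht α v c R).const_mul _) (integrable_expW_mul_eval ht α v c P)
  rw [integral_const_mul] at h
  exact (mul_eq_zero.1 h).resolve_left Complex.I_ne_zero

/-- The integral of `expW α t v * P` along the imaginary axis. -/
noncomputable def gaussMoment (α t v : ℝ) (P : Polynomial ℂ) : ℂ :=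
  lineIntegral 0 fun w => expW α t v w * P.eval w

theorem integral_expW_mul_add (ht : t ∈ Set.Ioo (0 : ℝ) 1) (α v c : ℝ) (P Q : Polynomial ℂ) :
    ∫ y : ℝ, expW α t v (c + y * Complex.I) * (P + Q).eval (c + y * Complex.I) =
      (∫ y : ℝ, expW α t v (c + y * Complex.I) * P.eval (c + y * Complex.I)) +
      ∫ y : ℝ, expW α t v (c + y * Complex.I) * Q.eval (c + y * Complex.I) := by
  rw [← integral_add (integrable_expW_mul_eval ht α v c P) (integrable_expW_mul_eval ht α v c Q)]
  simp only [Polynomial.eval_add, mul_add]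

theorem integral_expW_mul_C_mul (α t v c : ℝ) (a : ℂ) (P : Polynomial ℂ) :
    ∫ y : ℝ, expW α t v (c + y * Complex.I) * (Polynomial.C a * P).eval (c + y * Complex.I) =
      a * ∫ y : ℝ, expW α t v (c + y * Complex.I) * P.eval (c + y * Complex.I) := by
  rw [← integral_const_mul]
  simp only [Polynomial.eval_mul, Polynomial.eval_C, mul_left_comm]

/-- Integration by parts reduces the moments to the zeroth one, which does not depend on `c`. -/
theorem integral_expW_mul_X_pow (ht : t ∈ Set.Ioo (0 : ℝ) 1) (α v c : ℝ) (k : ℕ) :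
    ∫ y : ℝ, expW α t v (c + y * Complex.I) *
        (Polynomial.X ^ k : Polynomial ℂ).eval (c + y * Complex.I) =
      ∫ y : ℝ, expW α t v ((0 : ℝ) + y * Complex.I) *
        (Polynomial.X ^ k : Polynomial ℂ).eval ((0 : ℝ) + y * Complex.I) := by
  have h0 : (t : ℂ) ≠ 0 := by exact_mod_cast ht.1.ne'
  have h1 : (1 - (t : ℂ)) ≠ 0 := by exact_mod_cast (sub_pos.2 ht.2).ne'
  induction k using Nat.strong_induction_on with
  | _ k ih =>
    rcases k with _ | k
    · simp only [pow_zero, Polynomial.eval_one, mul_one, integral_expW ht]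
    · have key : (Polynomial.X ^ (k + 1) : Polynomial ℂ) =
          Polynomial.C ((1 - t : ℂ) / t) *
            ((Polynomial.C ((t : ℂ) / (1 - t)) * Polynomial.X +
              Polynomial.C (α - v / (1 - t) : ℂ)) * Polynomial.X ^ k +
              Polynomial.derivative (Polynomial.X ^ k)) +
          (Polynomial.C (-((1 - t : ℂ) / t) * (α - v / (1 - t) : ℂ)) * Polynomial.X ^ k +
            Polynomial.C (-((1 - t : ℂ) / t) * k) * Polynomial.X ^ (k - 1)) := by
        rw [Polynomial.derivative_X_pow]
        have hC : (Polynomial.C ((1 - t : ℂ) / t) * Polynomial.C ((t : ℂ) / (1 - t))) = 1 := by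
          rw [← Polynomial.C_mul, div_mul_div_cancel₀ h0, div_self h1, Polynomial.C_1]
        simp only [Polynomial.C_mul, Polynomial.C_neg]
        linear_combination (-Polynomial.X ^ (k + 1)) * hC
      have hA := integral_expW_parts ht α v c (Polynomial.X ^ k)
      have hA0 := integral_expW_parts ht α v 0 (Polynomial.X ^ k)
      rw [key]
      generalize ((Polynomial.C ((t : ℂ) / (1 - t)) * Polynomial.X +
        Polynomial.C (α - v / (1 - t) : ℂ)) * Polynomial.X ^ k +
        Polynomial.derivative (Polynomial.X ^ k)) = A at hA hA0
      simp only [integral_expW_mul_add ht, integral_expW_mul_C_mul, hA, hA0]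
      rw [ih k (Nat.lt_succ_self k)]
      rcases k with _ | k
      · simp
      · rw [ih (k + 1 - 1) (by omega)]

/-- The line of integration of a Gaussian times a polynomial may be moved. -/
theorem lineIntegral_expW_mul_eval (ht : t ∈ Set.Ioo (0 : ℝ) 1) (α v c : ℝ) (P : Polynomial ℂ) :
    lineIntegral c (fun w => expW α t v w * P.eval w) = gaussMoment α t v P := by
  unfold gaussMoment lineIntegral
  congr 1
  induction P using Polynomial.induction_on' with
  | add P Q hP hQ => rw [integral_expW_mul_add ht, integral_expW_mul_add ht, hP, hQ]
  | monomial k a =>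
    simp only [← Polynomial.C_mul_X_pow_eq_monomial, integral_expW_mul_C_mul]
    rw [integral_expW_mul_X_pow ht]

theorem gaussMoment_add (ht : t ∈ Set.Ioo (0 : ℝ) 1) (α v : ℝ) (P Q : Polynomial ℂ) :
    gaussMoment α t v (P + Q) = gaussMoment α t v P + gaussMoment α t v Q := by
  unfold gaussMoment lineIntegral
  rw [integral_expW_mul_add ht, mul_add]

theorem gaussMoment_C_mul (α t v : ℝ) (a : ℂ) (P : Polynomial ℂ) :
    gaussMoment α t v (Polynomial.C a * P) = a * gaussMoment α t v P := by
  unfold gaussMoment lineIntegral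
  rw [integral_expW_mul_C_mul, mul_left_comm]

theorem gaussMoment_sum (ht : t ∈ Set.Ioo (0 : ℝ) 1) (α v : ℝ) {ι : Type*} (s : Finset ι)
    (a : ι → ℂ) (P : ι → Polynomial ℂ) :
    gaussMoment α t v (∑ i ∈ s, Polynomial.C (a i) * P i) =
      ∑ i ∈ s, a i * gaussMoment α t v (P i) := by
  classical
  induction s using Finset.induction_on with
  | empty => simp [gaussMoment, lineIntegral]
  | insert i s hi ih =>
    rw [Finset.sum_insert hi, Finset.sum_insert hi, gaussMoment_add ht, gaussMoment_C_mul, ih]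

/-- The transition density is, up to Gaussian factors, the integral over the imaginary axis of
`w ↦ exp (μ w)` against the Gaussian weight. -/
theorem heatKernel_eq_lineIntegral (ht : t ∈ Set.Ioo (0 : ℝ) 1) (μ v : ℝ) :
    ((Real.exp (μ ^ 2 / 2 - v ^ 2 / (2 * (1 - t))) * heatKernel t μ v : ℝ) : ℂ) =
      (2 * (Real.pi : ℂ) * Complex.I * (Real.sqrt (1 - t) : ℂ))⁻¹ *
        lineIntegral 0 (expW μ t v) := by
  have h1 : 0 < 1 - t := sub_pos.2 ht.2
  have h0 := ht.1
  have hs : Real.sqrt (1 - t) ≠ 0 := (Real.sqrt_pos.2 h1).ne'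
  unfold lineIntegral
  rw [integral_expW ht, heatKernel, if_pos ht.1]
  have hI : (2 * (Real.pi : ℂ) * Complex.I * (Real.sqrt (1 - t) : ℂ))⁻¹ * Complex.I =
      (((2 * Real.pi * Real.sqrt (1 - t))⁻¹ : ℝ) : ℂ) := by
    have : (Real.sqrt (1 - t) : ℂ) ≠ 0 := by exact_mod_cast hs
    have hpi : (Real.pi : ℂ) ≠ 0 := by exact_mod_cast Real.pi_ne_zero
    push_cast
    field_simp
  rw [← mul_assoc _ Complex.I, hI, ← Complex.ofReal_mul]
  congr 1
  have hsq : Real.sqrt (2 * Real.pi * (1 - t) / t) =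
      2 * Real.pi * Real.sqrt (1 - t) * (1 / Real.sqrt (2 * Real.pi * t)) := by
    rw [Real.sqrt_eq_iff_mul_self_eq_of_pos (by positivity)]
    have e1 := Real.mul_self_sqrt h1.le
    have e2 := Real.mul_self_sqrt (show 0 ≤ 2 * Real.pi * t by positivity)
    have e3 : Real.sqrt (2 * Real.pi * t) ≠ 0 := (Real.sqrt_pos.2 (by positivity)).ne'
    calc 2 * Real.pi * Real.sqrt (1 - t) * (1 / Real.sqrt (2 * Real.pi * t)) *
          (2 * Real.pi * Real.sqrt (1 - t) * (1 / Real.sqrt (2 * Real.pi * t)))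
        = (2 * Real.pi) ^ 2 * (Real.sqrt (1 - t) * Real.sqrt (1 - t)) /
          (Real.sqrt (2 * Real.pi * t) * Real.sqrt (2 * Real.pi * t)) := by
          field_simp
      _ = _ := by
        rw [e1, e2]
        field_simp
  rw [hsq]
  have hexp : Real.exp (μ ^ 2 / 2 - v ^ 2 / (2 * (1 - t))) * Real.exp (-(μ - v) ^ 2 / (2 * t)) =
      Real.exp (-((μ - v / (1 - t)) ^ 2 * (1 - t) / (2 * t))) := by
    rw [← Real.exp_add]
    congr 1
    field_simp
    ring
  rw [← hexp]
  field_simp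

end Gaussian

/-! ### The limit of coalescing starting points -/

section Limit

theorem heatKernel_one (x y : ℝ) :
    heatKernel 1 x y =
      (Real.sqrt (2 * Real.pi))⁻¹ * Real.exp (-x ^ 2 / 2) * Real.exp (-y ^ 2 / 2) *
        Real.exp (x * y) := by
  rw [heatKernel, if_pos one_pos, mul_one, one_div, mul_assoc, mul_assoc, ← Real.exp_add,
    ← Real.exp_add]
  congr 2
  ring

theorem transitionMatrix_det_ne_zero {N : ℕ} {μ ν : Fin N → ℝ} (hμ : Function.Injective μ)
    (hν : StrictMono ν) : (transitionMatrix μ ν).det ≠ 0 := by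
  intro hdet
  obtain ⟨c, hc, h0⟩ := Matrix.exists_vecMul_eq_zero_iff.2 hdet
  apply hc
  have hsq : (Real.sqrt (2 * Real.pi))⁻¹ ≠ 0 := by positivity
  have h := expSum_coeff_eq_zero Finset.univ (k := N) (by simp) hμ
    (c := fun j => c j * Real.exp (-(μ j) ^ 2 / 2)) hν fun k => by
      have hk := congrFun h0 k
      simp only [Matrix.vecMul, dotProduct, transitionMatrix, Matrix.of_apply, heatKernel_one,
        Pi.zero_apply] at hk
      have h2 : (Real.sqrt (2 * Real.pi))⁻¹ * Real.exp (-(ν k) ^ 2 / 2) *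
          ∑ j, c j * Real.exp (-(μ j) ^ 2 / 2) * Real.exp (μ j * ν k) = 0 := by
        rw [← hk, Finset.mul_sum]
        exact Finset.sum_congr rfl fun j _ => by ring
      exact (mul_eq_zero.1 h2).resolve_left (mul_ne_zero hsq (Real.exp_pos _).ne')
  funext j
  exact (mul_eq_zero.1 (h j (Finset.mem_univ j))).resolve_right (Real.exp_pos _).ne'

theorem startPoints_strictMono (n m : ℕ) {a₁ a₂ : ℝ} (ha : a₁ < a₂) {K : ℕ} (hK : 1 ≤ K) :
    StrictMono (startPoints n m a₁ a₂ K) := by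
  intro i j hij
  have hK' : (0 : ℝ) < K := by exact_mod_cast hK
  have hij' : ((i : ℕ) : ℝ) < ((j : ℕ) : ℝ) := by exact_mod_cast hij
  have h1 : (a₂ - a₁) * ((i : ℕ) : ℝ) / K < (a₂ - a₁) * ((j : ℕ) : ℝ) / K :=
    div_lt_div_of_pos_right (mul_lt_mul_of_pos_left hij' (sub_pos.2 ha)) hK'
  have h2 : (if (i : ℕ) < n then a₁ else a₂) ≤ if (j : ℕ) < n then a₁ else a₂ := by
    have : (i : ℕ) < j := hij
    split_ifs <;> linarith
  exact add_lt_add_of_le_of_lt h2 h1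

/-- A bilinear form in `A⁻¹`, computed from a solution `c` of `c A = p`. -/
theorem sum_mul_inv_mul {N : ℕ} {A : Matrix (Fin N) (Fin N) ℝ} (hA : A.det ≠ 0)
    {p r : Fin N → ℝ} {c : Fin N → ℂ} (h : ∀ k, ∑ i, c i * (A i k : ℂ) = p k) :
    ((∑ j, ∑ k, p k * A⁻¹ k j * r j : ℝ) : ℂ) = ∑ i, c i * r i := by
  have h1 : ∀ i j, ∑ k, (A i k : ℂ) * (A⁻¹ k j : ℂ) = if i = j then 1 else 0 := by
    intro i j
    have := congrFun (congrFun (Matrix.mul_nonsing_inv A (isUnit_iff_ne_zero.2 hA)) i) j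
    rw [Matrix.mul_apply, Matrix.one_apply] at this
    rw [← Complex.ofReal_one, ← Complex.ofReal_zero, ← apply_ite Complex.ofReal, ← this]
    push_cast
    rfl
  push_cast
  calc ∑ j, ∑ k, (p k : ℂ) * (A⁻¹ k j : ℂ) * (r j : ℂ)
      = ∑ j, ∑ k, ∑ i, c i * ((A i k : ℂ) * (A⁻¹ k j : ℂ)) * r j := by
        refine Finset.sum_congr rfl fun j _ => Finset.sum_congr rfl fun k _ => ?_
        rw [← h k, Finset.sum_mul, Finset.sum_mul]
        exact Finset.sum_congr rfl fun i _ => by ring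
    _ = ∑ j, ∑ i, c i * (∑ k, (A i k : ℂ) * (A⁻¹ k j : ℂ)) * r j := by
        refine Finset.sum_congr rfl fun j _ => ?_
        rw [Finset.sum_comm]
        refine Finset.sum_congr rfl fun i _ => ?_
        rw [Finset.mul_sum, Finset.sum_mul]
    _ = ∑ i, c i * r i := by
        rw [Finset.sum_comm]
        simp only [h1, mul_ite, mul_one, mul_zero, ite_mul, zero_mul, Finset.sum_ite_eq,
          Finset.mem_univ, if_true]

theorem expW_eq_mul (α t v : ℝ) (w : ℂ) :
    expW α t v w = expW 0 t v w * Complex.exp (α * w) := by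
  rw [expW, expW, ← Complex.exp_add]
  congr 1
  push_cast
  ring

theorem expZ_eq_mul (α s u : ℝ) (z : ℂ) :
    expZ α s u z = expZ 0 s u z * Complex.exp (-(α * z)) := by
  rw [expZ, expZ, ← Complex.exp_add]
  congr 1
  push_cast
  ring

theorem lineIntegral_expW_mul_sum {t : ℝ} (ht : t ∈ Set.Ioo (0 : ℝ) 1) (v : ℝ) {N : ℕ}
    (c : Fin N → ℂ) (μ : Fin N → ℝ) :
    lineIntegral 0 (fun w => expW 0 t v w * ∑ j, c j * Complex.exp (μ j * w)) =
      ∑ j, c j * lineIntegral 0 (expW (μ j) t v) := by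
  have hi : ∀ j, Integrable fun y : ℝ => c j * expW (μ j) t v ((0 : ℝ) + y * Complex.I) := by
    intro j
    have := (integrable_expW_mul_eval ht (μ j) v 0 1).const_mul (c j)
    simpa only [Polynomial.eval_one, mul_one] using this
  have hpt : ∀ w, expW 0 t v w * ∑ j, c j * Complex.exp (μ j * w) =
      ∑ j, c j * expW (μ j) t v w := by
    intro w
    rw [Finset.mul_sum]
    exact Finset.sum_congr rfl fun j _ => by rw [expW_eq_mul (μ j)]; ring
  simp only [lineIntegral, hpt]
  rw [integral_finsetSum _ fun j _ => hi j, Finset.mul_sum]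
  refine Finset.sum_congr rfl fun j _ => ?_
  rw [integral_const_mul, mul_left_comm]

/-- The conjugated kernel in terms of the combination `∑ c j * exp (μ j * w)` of exponentials that
interpolates `expZ 0 s u` at the end points. -/
theorem kernelK_add_q_eq {n m : ℕ} {a₁ a₂ : ℝ} (ha : a₁ < a₂) {ν : Fin (n + m) → ℝ}
    (hν : StrictMono ν) {K : ℕ} (hK : 1 ≤ K) {s t : ℝ} (hs : s ∈ Set.Ioo (0 : ℝ) 1)
    (ht : t ∈ Set.Ioo (0 : ℝ) 1) (u v : ℝ) {c : Fin (n + m) → ℂ}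
    (hc : ∀ k, ∑ j, c j * Complex.exp (startPoints n m a₁ a₂ K j * ν k) = expZ 0 s u (ν k)) :
    (kernelK a₁ a₂ ν K s u t v : ℂ) + (q s u t v : ℂ) =
      (2 * (Real.pi : ℂ) * Complex.I * (Real.sqrt ((1 - s) * (1 - t)) : ℂ))⁻¹ *
        lineIntegral 0 (fun w => expW 0 t v w *
          ∑ j, c j * Complex.exp (startPoints n m a₁ a₂ K j * w)) := by
  set μ := startPoints n m a₁ a₂ K with hμ
  have hs1 : 0 < 1 - s := sub_pos.2 hs.2
  have hsq : (Real.sqrt (1 - s) : ℂ) ≠ 0 := by exact_mod_cast (Real.sqrt_pos.2 hs1).ne'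
  have hsq2 : (Real.sqrt (2 * Real.pi) : ℂ) ≠ 0 := by
    exact_mod_cast (Real.sqrt_pos.2 (by positivity : 0 < 2 * Real.pi)).ne'
  have hA := transitionMatrix_det_ne_zero (startPoints_strictMono n m ha hK).injective hν
  have hA' : ∀ k, ∑ j, (c j * Complex.exp (μ j ^ 2 / 2) *
      (Complex.exp (-(u ^ 2 / (2 * (1 - s)))) / Real.sqrt (1 - s))) *
        (transitionMatrix μ ν j k : ℂ) = (heatKernel (1 - s) u (ν k) : ℂ) := by
    intro k
    have h1 : ∀ j, (c j * Complex.exp (μ j ^ 2 / 2) *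
      (Complex.exp (-(u ^ 2 / (2 * (1 - s)))) / Real.sqrt (1 - s))) *
        (transitionMatrix μ ν j k : ℂ) = (Complex.exp (-(u ^ 2 / (2 * (1 - s)))) *
          Complex.exp (-(ν k) ^ 2 / 2) / (Real.sqrt (2 * Real.pi) * Real.sqrt (1 - s))) *
          (c j * Complex.exp (μ j * ν k)) := by
      intro j
      have h2 : Complex.exp (μ j ^ 2 / 2) * Complex.exp (-(μ j) ^ 2 / 2) = 1 := by
        rw [← Complex.exp_add, ← Complex.exp_zero]
        congr 1
        ring
      simp only [transitionMatrix, Matrix.of_apply, heatKernel_one]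
      push_cast
      generalize Complex.exp ((μ j : ℂ) ^ 2 / 2) = X₁ at h2 ⊢
      generalize Complex.exp (-(μ j : ℂ) ^ 2 / 2) = X₂ at h2 ⊢
      generalize Complex.exp (-(ν k : ℂ) ^ 2 / 2) = X₃
      field_simp
      linear_combination (c j * X₃) * h2
    simp_rw [h1]
    rw [← Finset.mul_sum, hc k, heatKernel, if_pos hs1,
      Real.sqrt_mul (show 0 ≤ 2 * Real.pi by positivity) (1 - s)]
    push_cast
    rw [expZ, div_mul_eq_mul_div, ← Complex.exp_add, ← Complex.exp_add, one_div,
      inv_mul_eq_div]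
    congr 2
    have : (1 - (s : ℂ)) ≠ 0 := by exact_mod_cast hs1.ne'
    push_cast
    field_simp
    ring
  have h := sum_mul_inv_mul hA (r := fun j => heatKernel t (μ j) v) hA'
  rw [← Complex.ofReal_add, kernelK, q, brownianKernel, ← mul_add, neg_add_eq_sub, sub_add_cancel,
    Complex.ofReal_mul, h, lineIntegral_expW_mul_sum ht, Finset.mul_sum, Finset.mul_sum]
  refine Finset.sum_congr rfl fun j _ => ?_
  have h3 := heatKernel_eq_lineIntegral ht (μ j) v
  have h4 : ((Real.exp (μ j ^ 2 / 2 - v ^ 2 / (2 * (1 - t))) * heatKernel t (μ j) v : ℝ) : ℂ) =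
      (conjFactor s u t v : ℂ) * Complex.exp (μ j ^ 2 / 2) *
        Complex.exp (-(u ^ 2 / (2 * (1 - s)))) * heatKernel t (μ j) v := by
    rw [Complex.ofReal_mul, conjFactor]
    congr 1
    push_cast
    rw [← Complex.exp_add, ← Complex.exp_add]
    congr 1
    ring
  rw [h4] at h3
  have hsq3 : (2 * (Real.pi : ℂ) * Complex.I * (Real.sqrt ((1 - s) * (1 - t)) : ℂ))⁻¹ =
      (2 * (Real.pi : ℂ) * Complex.I * (Real.sqrt (1 - t) : ℂ))⁻¹ * (Real.sqrt (1 - s) : ℂ)⁻¹ := by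
    rw [Real.sqrt_mul hs1.le, ← mul_inv]
    push_cast
    ring
  rw [hsq3]
  linear_combination (c j * (Real.sqrt (1 - s) : ℂ)⁻¹) * h3

/-- The difference quotient `(exp (b w) - 1) / b`, with value `w` at `b = 0`. -/
noncomputable def expQuot (b : ℝ) (w : ℂ) : ℂ :=
  if b = 0 then w else (Complex.exp (b * w) - 1) / b

/-- A basis of the span of the functions `w ↦ exp (μ j * w)`, where the `μ j` are the starting
points with spacing `b`. It converges as `b → 0`, to a basis of
`{exp (a₁ w) P(w) + exp (a₂ w) Q(w) | deg P < n, deg Q < m}`. -/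
noncomputable def coalescingBasis (a₁ a₂ : ℝ) (n m : ℕ) (b : ℝ) : Fin n ⊕ Fin m → ℂ → ℂ
  | .inl i, w => Complex.exp (a₁ * w) * expQuot b w ^ (i : ℕ)
  | .inr i, w => Complex.exp ((a₂ + b * n : ℝ) * w) * expQuot b w ^ (i : ℕ)

theorem expQuot_pow_eq_sum {b : ℝ} (hb : b ≠ 0) {k : ℕ} (i : Fin k) :
    ∃ g : Fin k → ℂ, ∀ w : ℂ, expQuot b w ^ (i : ℕ) =
      ∑ l, g l * Complex.exp ((b * (l : ℕ) : ℝ) * w) := by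
  set R : Polynomial ℂ := (Polynomial.X - Polynomial.C 1) ^ (i : ℕ) with hR
  have hdeg : R.natDegree < k := by
    rw [hR, Polynomial.natDegree_pow, Polynomial.natDegree_X_sub_C, mul_one]
    exact i.2
  refine ⟨fun l => R.coeff l / (b : ℂ) ^ (i : ℕ), fun w => ?_⟩
  have h1 : (Complex.exp (b * w) - 1) ^ (i : ℕ) = R.eval (Complex.exp (b * w)) := by
    simp [hR]
  rw [expQuot, if_neg hb, div_pow, h1, Polynomial.eval_eq_sum_range' hdeg,
    ← Fin.sum_univ_eq_sum_range (fun l => R.coeff l * Complex.exp (b * w) ^ l), Finset.sum_div]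
  refine Finset.sum_congr rfl fun l _ => ?_
  rw [← Complex.exp_nat_mul]
  push_cast
  rw [div_mul_eq_mul_div]
  congr 3
  ring

theorem coalescingBasis_mem_span {n m : ℕ} {a₁ a₂ : ℝ} (ha : a₁ < a₂) {K : ℕ} (hK : 1 ≤ K)
    (i : Fin n ⊕ Fin m) :
    ∃ T : Fin (n + m) → ℂ, ∀ w : ℂ, coalescingBasis a₁ a₂ n m ((a₂ - a₁) / K) i w =
      ∑ j, T j * Complex.exp (startPoints n m a₁ a₂ K j * w) := by
  have hb : (a₂ - a₁) / (K : ℝ) ≠ 0 :=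
    (div_pos (sub_pos.2 ha) (by exact_mod_cast hK)).ne'
  rcases i with i | i
  · obtain ⟨g, hg⟩ := expQuot_pow_eq_sum hb i
    refine ⟨Fin.append g 0, fun w => ?_⟩
    rw [Fin.sum_univ_add]
    simp only [Fin.append_left, Fin.append_right, Pi.zero_apply, zero_mul,
      Finset.sum_const_zero, add_zero, coalescingBasis, hg, Finset.mul_sum]
    refine Finset.sum_congr rfl fun l _ => ?_
    rw [mul_left_comm, ← Complex.exp_add]
    congr 2
    rw [startPoints, if_pos (by simp)]
    push_cast
    simp only [Fin.val_castAdd]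
    ring
  · obtain ⟨g, hg⟩ := expQuot_pow_eq_sum hb i
    refine ⟨Fin.append 0 g, fun w => ?_⟩
    rw [Fin.sum_univ_add]
    simp only [Fin.append_left, Fin.append_right, Pi.zero_apply, zero_mul,
      Finset.sum_const_zero, zero_add, coalescingBasis, hg, Finset.mul_sum]
    refine Finset.sum_congr rfl fun l _ => ?_
    rw [mul_left_comm, ← Complex.exp_add]
    congr 2
    rw [startPoints, if_neg (by simp)]
    simp only [Fin.val_natAdd]
    push_cast
    ring

theorem tendsto_expQuot (w : ℂ) : Tendsto (fun b => expQuot b w) (𝓝 0) (𝓝 (expQuot 0 w)) := by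
  have h0 : expQuot 0 w = w := if_pos rfl
  have hd : HasDerivAt (fun b : ℝ => Complex.exp (b * w)) w 0 := by
    have := ((Complex.ofRealCLM.hasDerivAt (x := (0 : ℝ))).mul_const w).cexp
    simpa using this
  refine continuousAt_iff_punctured_nhds.2 ?_
  rw [h0]
  refine (hasDerivAt_iff_tendsto_slope.1 hd).congr' ?_
  filter_upwards [self_mem_nhdsWithin] with b hb
  rw [expQuot, if_neg (show ¬b = 0 from hb), slope_def_module, sub_zero, Complex.ofReal_zero, zero_mul,
    Complex.exp_zero, Complex.real_smul, Complex.ofReal_inv, inv_mul_eq_div]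

theorem tendsto_coalescingBasis (a₁ a₂ : ℝ) (n m : ℕ) (i : Fin n ⊕ Fin m) (w : ℂ) :
    Tendsto (fun b => coalescingBasis a₁ a₂ n m b i w) (𝓝 0)
      (𝓝 (coalescingBasis a₁ a₂ n m 0 i w)) := by
  rcases i with i | i
  · exact ((tendsto_expQuot w).pow i).const_mul _
  · refine Tendsto.mul ?_ ((tendsto_expQuot w).pow i)
    have : Continuous fun b : ℝ => Complex.exp ((a₂ + b * n : ℝ) * w) := by fun_prop
    exact this.tendsto 0

/-- On the imaginary axis the basis functions are dominated by powers, uniformly in `b`. -/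
theorem norm_coalescingBasis_le (a₁ a₂ : ℝ) (n m : ℕ) (b : ℝ) (i : Fin n ⊕ Fin m) (y : ℝ) :
    ‖coalescingBasis a₁ a₂ n m b i (y * Complex.I)‖ ≤
      ‖(y : ℂ) ^ Sum.elim (fun i : Fin n => (i : ℕ)) (fun i : Fin m => (i : ℕ)) i‖ := by
  have hexp : ∀ x : ℝ, ‖Complex.exp (x * (y * Complex.I))‖ = 1 := by
    intro x
    rw [← mul_assoc, ← Complex.ofReal_mul, Complex.norm_exp_ofReal_mul_I]
  have hq : ‖expQuot b (y * Complex.I)‖ ≤ ‖(y : ℂ)‖ := by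
    rw [expQuot]
    split_ifs with hb
    · simp
    · rw [norm_div, div_le_iff₀ (by simpa using hb)]
      have := Real.norm_exp_I_mul_ofReal_sub_one_le (x := b * y)
      rw [mul_comm, ← norm_mul, ← Complex.ofReal_mul]
      refine le_trans (le_of_eq ?_) (this.trans (le_of_eq ?_))
      · congr 3
        push_cast
        ring
      · simp [mul_comm]
  rcases i with i | i
  · simp only [coalescingBasis, norm_mul, norm_pow, hexp, one_mul, Sum.elim_inl]
    exact pow_le_pow_left₀ (norm_nonneg _) hq _
  · simp only [coalescingBasis, norm_mul, norm_pow, hexp, one_mul, Sum.elim_inr]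
    exact pow_le_pow_left₀ (norm_nonneg _) hq _

theorem continuous_coalescingBasis (a₁ a₂ : ℝ) (n m : ℕ) (b : ℝ) (i : Fin n ⊕ Fin m) :
    Continuous (coalescingBasis a₁ a₂ n m b i) := by
  have hq : Continuous (expQuot b) := by
    unfold expQuot
    split_ifs <;> fun_prop
  rcases i with i | i
  · change Continuous fun w => Complex.exp (a₁ * w) * expQuot b w ^ (i : ℕ)
    fun_prop
  · change Continuous fun w => Complex.exp ((a₂ + b * n : ℝ) * w) * expQuot b w ^ (i : ℕ)
    fun_prop

theorem tendsto_lineIntegral_coalescingBasis (a₁ a₂ : ℝ) (n m : ℕ) {t : ℝ}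
    (ht : t ∈ Set.Ioo (0 : ℝ) 1) (v : ℝ) (i : Fin n ⊕ Fin m) :
    Tendsto (fun b => lineIntegral 0 fun w => expW 0 t v w * coalescingBasis a₁ a₂ n m b i w) (𝓝 0)
      (𝓝 (lineIntegral 0 fun w => expW 0 t v w * coalescingBasis a₁ a₂ n m 0 i w)) := by
  unfold lineIntegral
  refine Tendsto.const_mul _ ?_
  refine tendsto_integral_filter_of_dominated_convergence
    (fun y : ℝ => ‖expW 0 t v ((0 : ℝ) + y * Complex.I) * (Polynomial.X ^
      Sum.elim (fun i : Fin n => (i : ℕ)) (fun i : Fin m => (i : ℕ)) i : Polynomial ℂ).eval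
        ((0 : ℝ) + y * Complex.I)‖) ?_ ?_ (integrable_expW_mul_eval ht 0 v 0 _).norm ?_
  · refine Eventually.of_forall fun b => Continuous.aestronglyMeasurable ?_
    have h1 := continuous_coalescingBasis a₁ a₂ n m b i
    have h2 := continuous_expW 0 t v
    fun_prop
  · refine Eventually.of_forall fun b => ae_of_all _ fun y => ?_
    rw [norm_mul, norm_mul]
    refine mul_le_mul_of_nonneg_left ?_ (norm_nonneg _)
    rw [Complex.ofReal_zero, zero_add]
    refine (norm_coalescingBasis_le a₁ a₂ n m b i y).trans (le_of_eq ?_)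
    simp
  · exact ae_of_all _ fun y => (tendsto_coalescingBasis a₁ a₂ n m i _).const_mul _

theorem eq_sum_C_mul_X_pow {n : ℕ} {P : Polynomial ℂ} (hP : P.degree < n) :
    P = ∑ i : Fin n, Polynomial.C (P.coeff i) * Polynomial.X ^ (i : ℕ) := by
  rw [Fin.sum_univ_eq_sum_range (fun i => Polynomial.C (P.coeff i) * Polynomial.X ^ i)]
  ext j
  rw [Polynomial.finsetSum_coeff]
  simp only [Polynomial.coeff_C_mul_X_pow, Finset.sum_ite_eq, Finset.mem_range]
  split_ifs with h
  · rfl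
  · exact (Polynomial.degree_lt_iff_coeff_zero _ _).1 hP j (not_lt.1 h)

/-- Interpolation by `exp (a₁ w) P(w) + exp (a₂ w) Q(w)` is uniquely solvable. -/
theorem det_coalescingBasis_ne_zero {n m : ℕ} {a₁ a₂ : ℝ} (ha : a₁ < a₂)
    {x : Fin n ⊕ Fin m → ℝ} (hx : Function.Injective x) :
    (Matrix.of fun i k => coalescingBasis a₁ a₂ n m 0 i (x k)).det ≠ 0 := by
  intro hdet
  obtain ⟨c, hc, h0⟩ := Matrix.exists_vecMul_eq_zero_iff.2 hdet
  apply hc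
  obtain ⟨hP, hQ⟩ := expPoly_eq_zero (sub_pos.2 ha).ne' (n := n) (m := m) (by simp) hx
    (Polynomial.degree_sum_fin_lt fun i => c (.inl i))
    (Polynomial.degree_sum_fin_lt fun i => c (.inr i)) fun k => by
      have hk := congrFun h0 k
      simp only [Matrix.vecMul, dotProduct, Matrix.of_apply, Fintype.sum_sum_type,
        coalescingBasis, expQuot, if_true, Pi.zero_apply, zero_mul, add_zero] at hk
      have hexp : Complex.exp ((a₂ - a₁ : ℝ) * x k) =
          Complex.exp (-(a₁ * x k)) * Complex.exp (a₂ * x k) := by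
        rw [← Complex.exp_add]
        congr 1
        push_cast
        ring
      have hone : Complex.exp (-(a₁ * x k)) * Complex.exp (a₁ * x k) = 1 := by
        rw [← Complex.exp_add, neg_add_cancel, Complex.exp_zero]
      simp only [Polynomial.eval_finsetSum, Polynomial.eval_mul, Polynomial.eval_C,
        Polynomial.eval_pow, Polynomial.eval_X, hexp]
      have h1 : ∑ i : Fin n, c (.inl i) * (Complex.exp (a₁ * x k) * (x k : ℂ) ^ (i : ℕ)) =
          Complex.exp (a₁ * x k) * ∑ i : Fin n, c (.inl i) * (x k : ℂ) ^ (i : ℕ) := by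
        rw [Finset.mul_sum]
        exact Finset.sum_congr rfl fun i _ => by ring
      have h2 : ∑ i : Fin m, c (.inr i) * (Complex.exp (a₂ * x k) * (x k : ℂ) ^ (i : ℕ)) =
          Complex.exp (a₂ * x k) * ∑ i : Fin m, c (.inr i) * (x k : ℂ) ^ (i : ℕ) := by
        rw [Finset.mul_sum]
        exact Finset.sum_congr rfl fun i _ => by ring
      rw [h1, h2] at hk
      linear_combination Complex.exp (-(a₁ * x k)) * hk -
        (∑ i : Fin n, c (.inl i) * (x k : ℂ) ^ (i : ℕ)) * hone
  have hcoeff : ∀ {k : ℕ} (g : Fin k → ℂ),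
      ∑ i : Fin k, Polynomial.C (g i) * Polynomial.X ^ (i : ℕ) = 0 → ∀ i, g i = 0 := by
    intro k g hg i
    have := congrArg (fun R => Polynomial.coeff R (i : ℕ)) hg
    simpa [Polynomial.finsetSum_coeff, Polynomial.coeff_C_mul_X_pow, Fin.val_inj] using this
  funext k
  rcases k with i | i
  · exact hcoeff _ hP i
  · exact hcoeff _ hQ i

theorem tendsto_matrix_inv {σ : Type*} [Fintype σ] [DecidableEq σ] {β : Type*} {l : Filter β}
    {M : β → Matrix σ σ ℂ} {A : Matrix σ σ ℂ} (hM : Tendsto M l (𝓝 A)) (hA : A.det ≠ 0) :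
    Tendsto (fun b => (M b)⁻¹) l (𝓝 A⁻¹) := by
  simp only [Matrix.inv_def, Ring.inverse_eq_inv']
  have hdet := ((continuous_id (X := Matrix σ σ ℂ)).matrix_det.tendsto A).comp hM
  have hadj := ((continuous_id (X := Matrix σ σ ℂ)).matrix_adjugate.tendsto A).comp hM
  exact (hdet.inv₀ hA).smul hadj

/-- As the starting points coalesce, the interpolating sums of exponentials converge to
`exp (a₁ w) P(w) + exp (a₂ w) Q(w)`, which interpolates the same values. -/
theorem tendsto_kernelK_add_q {n m : ℕ} {a₁ a₂ : ℝ} (ha : a₁ < a₂) {ν : Fin (n + m) → ℝ}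
    (hν : StrictMono ν) {s t : ℝ} (hs : s ∈ Set.Ioo (0 : ℝ) 1)
    (ht : t ∈ Set.Ioo (0 : ℝ) 1) (u v : ℝ) {P Q : Polynomial ℂ} (hP : P.degree < n)
    (hQ : Q.degree < m)
    (hPQ : ∀ k, Complex.exp (a₁ * ν k) * P.eval (ν k : ℂ) +
      Complex.exp (a₂ * ν k) * Q.eval (ν k : ℂ) = expZ 0 s u (ν k)) :
    Tendsto (fun K : ℕ => (kernelK a₁ a₂ ν K s u t v : ℂ) + (q s u t v : ℂ)) atTop
      (𝓝 ((2 * (Real.pi : ℂ) * Complex.I * (Real.sqrt ((1 - s) * (1 - t)) : ℂ))⁻¹ *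
        (gaussMoment a₁ t v P + gaussMoment a₂ t v Q))) := by
  set x : Fin n ⊕ Fin m → ℝ := fun k => ν (finSumFinEquiv k) with hx
  have hxi : Function.Injective x := hν.injective.comp finSumFinEquiv.injective
  set e : Fin n ⊕ Fin m → ℂ := fun k => expZ 0 s u (x k) with he
  set Φ : ℝ → Matrix (Fin n ⊕ Fin m) (Fin n ⊕ Fin m) ℂ := fun b =>
    Matrix.of fun i k => coalescingBasis a₁ a₂ n m b i (x k) with hΦ
  set d : Fin n ⊕ Fin m → ℂ := Sum.elim (fun i => P.coeff i) fun i => Q.coeff i with hd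
  set b : ℕ → ℝ := fun K => (a₂ - a₁) / K with hb
  have hb0 : Tendsto b atTop (𝓝 0) := tendsto_const_div_atTop_nhds_zero_nat _
  have hdet : (Φ 0).det ≠ 0 := det_coalescingBasis_ne_zero ha hxi
  have hΦlim : Tendsto (fun K => Φ (b K)) atTop (𝓝 (Φ 0)) := by
    refine tendsto_pi_nhds.2 fun i => tendsto_pi_nhds.2 fun k => ?_
    exact (tendsto_coalescingBasis a₁ a₂ n m i (x k)).comp hb0
  have hdΦ : Matrix.vecMul d (Φ 0) = e := by
    funext k
    have h1 := hPQ (finSumFinEquiv k)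
    change _ = expZ 0 s u (ν (finSumFinEquiv k))
    rw [← h1]
    simp only [hΦ, hd, Matrix.vecMul, dotProduct, Fintype.sum_sum_type, Matrix.of_apply,
      Sum.elim_inl, Sum.elim_inr, coalescingBasis, expQuot, if_true, zero_mul, add_zero]
    conv_rhs => rw [eq_sum_C_mul_X_pow hP, eq_sum_C_mul_X_pow hQ]
    simp only [Polynomial.eval_finsetSum, Polynomial.eval_mul, Polynomial.eval_C,
      Polynomial.eval_pow, Polynomial.eval_X, Finset.mul_sum, hx]
    congr 1 <;> exact Finset.sum_congr rfl fun i _ => by ring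
  have hdlim : Tendsto (fun K => Matrix.vecMul e (Φ (b K))⁻¹) atTop (𝓝 d) := by
    have h1 : d = Matrix.vecMul e (Φ 0)⁻¹ := by
      rw [← hdΦ, Matrix.vecMul_vecMul, Matrix.mul_nonsing_inv _ (isUnit_iff_ne_zero.2 hdet),
        Matrix.vecMul_one]
    rw [h1]
    have h2 := tendsto_matrix_inv hΦlim hdet
    have h3 : Continuous fun M : Matrix (Fin n ⊕ Fin m) (Fin n ⊕ Fin m) ℂ =>
        Matrix.vecMul e M := continuous_const.matrix_vecMul continuous_id
    exact (h3.tendsto _).comp h2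
  have hlim : Tendsto (fun K => (2 * (Real.pi : ℂ) * Complex.I *
      (Real.sqrt ((1 - s) * (1 - t)) : ℂ))⁻¹ * ∑ i, Matrix.vecMul e (Φ (b K))⁻¹ i *
        lineIntegral 0 fun w => expW 0 t v w * coalescingBasis a₁ a₂ n m (b K) i w) atTop
      (𝓝 ((2 * (Real.pi : ℂ) * Complex.I * (Real.sqrt ((1 - s) * (1 - t)) : ℂ))⁻¹ *
        ∑ i, d i * lineIntegral 0 fun w => expW 0 t v w * coalescingBasis a₁ a₂ n m 0 i w)) := by
    refine Tendsto.const_mul _ (tendsto_finsetSum _ fun i _ => ?_)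
    exact ((tendsto_pi_nhds.1 hdlim) i).mul
      ((tendsto_lineIntegral_coalescingBasis a₁ a₂ n m ht v i).comp hb0)
  have hval : ∑ i, d i * (lineIntegral 0 fun w => expW 0 t v w * coalescingBasis a₁ a₂ n m 0 i w) =
      gaussMoment a₁ t v P + gaussMoment a₂ t v Q := by
    conv_rhs => rw [eq_sum_C_mul_X_pow hP, eq_sum_C_mul_X_pow hQ, gaussMoment_sum ht,
      gaussMoment_sum ht]
    rw [Fintype.sum_sum_type]
    congr 1
    · refine Finset.sum_congr rfl fun i _ => ?_
      simp only [hd, Sum.elim_inl, gaussMoment, coalescingBasis, expQuot, if_true,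
        expW_eq_mul a₁, Polynomial.eval_pow, Polynomial.eval_X, mul_assoc]
    · refine Finset.sum_congr rfl fun i _ => ?_
      simp only [hd, Sum.elim_inr, gaussMoment, coalescingBasis, expQuot, if_true,
        expW_eq_mul a₂, Polynomial.eval_pow, Polynomial.eval_X, mul_assoc, zero_mul, add_zero]
  rw [hval] at hlim
  -- For large `K` the interpolant in the coalescing basis is a combination of the functions
  -- `exp (μ_j w)`, so that it computes the kernel.
  refine hlim.congr' ?_
  have hev : ∀ᶠ K in atTop, (Φ (b K)).det ≠ 0 := by
    have h1 := ((continuous_id (X := Matrix (Fin n ⊕ Fin m) (Fin n ⊕ Fin m) ℂ)).matrix_det.tendsto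
      (Φ 0)).comp hΦlim
    exact h1.eventually_ne hdet
  filter_upwards [hev, eventually_ge_atTop 1] with K hK hK1
  choose T hT using fun i => coalescingBasis_mem_span (n := n) (m := m) ha hK1 i
  set g := Matrix.vecMul e (Φ (b K))⁻¹ with hg
  have hsum : ∀ w : ℂ, ∑ j, (∑ i, g i * T i j) * Complex.exp (startPoints n m a₁ a₂ K j * w) =
      ∑ i, g i * coalescingBasis a₁ a₂ n m (b K) i w := by
    intro w
    simp only [hb, hT, Finset.mul_sum, Finset.sum_mul]
    rw [Finset.sum_comm]
    exact Finset.sum_congr rfl fun i _ => Finset.sum_congr rfl fun j _ => by ring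
  have hgΦ : Matrix.vecMul g (Φ (b K)) = e := by
    rw [hg, Matrix.vecMul_vecMul, Matrix.nonsing_inv_mul _ (isUnit_iff_ne_zero.2 hK),
      Matrix.vecMul_one]
  rw [kernelK_add_q_eq ha hν hK1 hs ht u v (c := fun j => ∑ i, g i * T i j) fun k => by
    have h1 := congrFun hgΦ (finSumFinEquiv.symm k)
    rw [hsum]
    simpa [Matrix.vecMul, dotProduct, hΦ, he, hx] using h1]
  simp only [hsum]
  have hswap : lineIntegral 0 (fun w => expW 0 t v w *
      ∑ i, g i * coalescingBasis a₁ a₂ n m (b K) i w) =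
      ∑ i, g i * lineIntegral 0 fun w => expW 0 t v w * coalescingBasis a₁ a₂ n m (b K) i w := by
    simp only [hb, hT, lineIntegral_expW_mul_sum ht]
    simp only [← hT]
    have := lineIntegral_expW_mul_sum ht v (fun j => ∑ i, g i * T i j) (startPoints n m a₁ a₂ K)
    simp only [hsum, hb] at this
    rw [this]
    simp only [Finset.mul_sum, Finset.sum_mul]
    rw [Finset.sum_comm]
    exact Finset.sum_congr rfl fun i _ => Finset.sum_congr rfl fun j _ => by ring
  rw [hswap]

end Limit

/-! ### Iterated contour integrals and pairings on the half line -/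

section IteratedIntegrals

variable {ι ι' : Type*} [Fintype ι] [DecidableEq ι] [Fintype ι'] [DecidableEq ι']
  {γ γ' : ℝ → ℂ} {ε : ℝ} {p : ι → ℂ} {p' : ι' → ℂ}

theorem ne_zero_of_mem_halfPlane {z : ℂ} (hz : z ∈ halfPlane ε) : z ≠ 0 := by
  rintro rfl
  simp [halfPlane] at hz

theorem ne_of_mem_halfPlane {z w : ℂ} (hz : z ∈ halfPlane ε) (hw : w ∈ halfPlane (-ε)) :
    z ≠ w := by
  rintro rfl
  simp only [halfPlane, Set.mem_ofPred_eq] at hz hw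
  linarith

/-- The residue theorem in two variables, for contours in opposite half planes. -/
theorem contourIntegral_residue_residue (hε : ε ^ 2 = 1)
    (hγ : IsContour γ (halfPlane ε) p) (hγ' : IsContour γ' (halfPlane (-ε)) p')
    (hp : Function.Injective p) (hp' : Function.Injective p')
    (hpU : ∀ j, p j ∈ halfPlane ε) (hpU' : ∀ j, p' j ∈ halfPlane (-ε)) {G : ℂ → ℂ → ℂ}
    (hG : ∀ ζ ∈ halfPlane ε, DifferentiableOn ℂ (G ζ) (halfPlane (-ε)))
    (hG' : ∀ ω ∈ halfPlane (-ε), DifferentiableOn ℂ (fun ζ => G ζ ω) (halfPlane ε)) :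
    contourIntegral γ (fun ζ => contourIntegral γ' fun ω =>
        G ζ ω * (rootProd p ζ)⁻¹ * (rootProd p' ω)⁻¹) =
      (2 * (Real.pi : ℂ) * Complex.I) ^ 2 *
        ∑ l, ∑ k, resWeight p k * resWeight p' l * G (p k) (p' l) := by
  have h1 : contourIntegral γ (fun ζ => contourIntegral γ' fun ω =>
      G ζ ω * (rootProd p ζ)⁻¹ * (rootProd p' ω)⁻¹) =
      contourIntegral γ (fun ζ => (2 * (Real.pi : ℂ) * Complex.I *
        ∑ l, resWeight p' l * G ζ (p' l)) * (rootProd p ζ)⁻¹) := by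
    refine contourIntegral_congr fun τ hτ => ?_
    have hf : DifferentiableOn ℂ (fun ω => G (γ τ) ω * (rootProd p (γ τ))⁻¹) (halfPlane (-ε)) :=
      (hG _ (hγ.mapsTo hτ)).mul_const _
    rw [hγ'.integral_mul_inv_rootProd (by rw [neg_sq, hε]) hp' hpU' hf,
      mul_assoc (2 * (Real.pi : ℂ) * Complex.I), Finset.sum_mul]
    congr 1
    exact Finset.sum_congr rfl fun l _ => by ring
  have hd : DifferentiableOn ℂ (fun ζ => 2 * (Real.pi : ℂ) * Complex.I *
      ∑ l, resWeight p' l * G ζ (p' l)) (halfPlane ε) :=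
    (DifferentiableOn.fun_sum fun l _ => (hG' _ (hpU' l)).const_mul _).const_mul _
  rw [h1, hγ.integral_mul_inv_rootProd hε hp hpU hd, Finset.sum_comm, sq,
    mul_assoc (2 * (Real.pi : ℂ) * Complex.I)]
  congr 1
  rw [Finset.mul_sum]
  refine Finset.sum_congr rfl fun k _ => ?_
  simp only [Finset.mul_sum]
  exact Finset.sum_congr rfl fun l _ => by ring

/-- For `w` outside of the half plane, only the poles `p k` of `F z * R w / ((z - w) * R z)`
contribute, where `R = rootProd p`. Their residues are, up to sign, `F (p k)` times the Lagrange
basis polynomials at `w`. -/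
theorem contourIntegral_eq_sum_lagrangeBasis (hε : ε ^ 2 = 1)
    (hγ : IsContour γ (halfPlane ε) p) (hp : Function.Injective p)
    (hpU : ∀ j, p j ∈ halfPlane ε) {F : ℂ → ℂ} (hF : DifferentiableOn ℂ F (halfPlane ε)) {w : ℂ}
    (hw : w ∉ halfPlane ε) :
    contourIntegral γ (fun z => F z * (z - w)⁻¹ * rootProd p w * (rootProd p z)⁻¹) =
      -(2 * (Real.pi : ℂ) * Complex.I) * ∑ k, F (p k) * (lagrangeBasis p k).eval w := by
  have hne : ∀ z ∈ halfPlane ε, z - w ≠ 0 := by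
    rintro z hz h
    exact hw (sub_eq_zero.1 h ▸ hz)
  have hd : DifferentiableOn ℂ (fun z => F z * (z - w)⁻¹ * rootProd p w) (halfPlane ε) :=
    (hF.mul ((differentiableOn_id.sub_const w).inv hne)).mul_const _
  rw [hγ.integral_mul_inv_rootProd hε hp hpU hd, neg_mul, ← mul_neg]
  congr 1
  rw [← Finset.sum_neg_distrib]
  refine Finset.sum_congr rfl fun k _ => ?_
  have h := resWeight_mul_rootProd (fun j => ne_zero_of_mem_halfPlane (hpU j)) k w
  have hk := hne _ (hpU k)
  calc resWeight p k * (F (p k) * (p k - w)⁻¹ * rootProd p w)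
      = F (p k) * (p k - w)⁻¹ * (resWeight p k * rootProd p w) := by ring
    _ = -(F (p k) * (lagrangeBasis p k).eval w) * ((p k - w)⁻¹ * (p k - w)) := by
      rw [h]
      ring
    _ = _ := by rw [inv_mul_cancel₀ hk, mul_one]

theorem lineIntegral_congr {c : ℝ} {f g : ℂ → ℂ}
    (h : ∀ y : ℝ, f (c + y * Complex.I) = g (c + y * Complex.I)) :
    lineIntegral c f = lineIntegral c g := by
  simp only [lineIntegral, h]

theorem lineIntegral_const_mul (c : ℝ) (a : ℂ) (f : ℂ → ℂ) :
    lineIntegral c (fun w => a * f w) = a * lineIntegral c f := by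
  unfold lineIntegral
  rw [integral_const_mul, mul_left_comm]

theorem lineIntegral_contourIntegral (hε : ε ^ 2 = 1)
    (hγ : IsContour γ (halfPlane ε) p) (hp : Function.Injective p)
    (hpU : ∀ j, p j ∈ halfPlane ε) {F : ℂ → ℂ} (hF : DifferentiableOn ℂ F (halfPlane ε))
    {c : ℝ} (hc : 0 ≤ ε * c) {t : ℝ} (ht : t ∈ Set.Ioo (0 : ℝ) 1) (α v : ℝ) :
    lineIntegral c (fun w => contourIntegral γ fun z =>
        expW α t v w * (F z * (z - w)⁻¹ * rootProd p w * (rootProd p z)⁻¹)) =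
      -(2 * (Real.pi : ℂ) * Complex.I) *
        ∑ k, F (p k) * gaussMoment α t v (lagrangeBasis p k) := by
  rw [← gaussMoment_sum ht, ← lineIntegral_expW_mul_eval ht α v c, ← lineIntegral_const_mul]
  refine lineIntegral_congr fun y => ?_
  rw [contourIntegral_const_mul, contourIntegral_eq_sum_lagrangeBasis hε hγ hp hpU hF,
    mul_left_comm]
  · simp only [Polynomial.eval_finsetSum, Polynomial.eval_mul, Polynomial.eval_C]
  · simpa [halfPlane] using hc

section HalfLine

variable {a : ℝ}

theorem exp_mul_exp_eq (z z' : ℂ) (x : ℝ) :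
    Complex.exp (-(ε * a * x * z')) * Complex.exp (ε * a * x * z) =
      Complex.exp (ε * a * (z - z') * x) := by
  rw [← Complex.exp_add]
  congr 1
  ring

theorem rate_re_neg (ha : 0 < a) {z z' : ℂ} (h : ε * (z - z').re < 0) :
    ((ε : ℂ) * a * (z - z')).re < 0 := by
  rw [← Complex.ofReal_mul, Complex.re_ofReal_mul]
  nlinarith

theorem integrableOn_exp_mul_exp (ha : 0 < a) {z z' : ℂ} (h : ε * (z - z').re < 0) :
    IntegrableOn (fun x : ℝ => Complex.exp (-(ε * a * x * z')) * Complex.exp (ε * a * x * z))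
      (Set.Ici 1) := by
  rw [integrableOn_Ici_iff_integrableOn_Ioi]
  simp only [exp_mul_exp_eq]
  exact integrableOn_exp_mul_complex_Ioi (rate_re_neg ha h) 1

theorem integral_exp_mul_exp (hε : ε ^ 2 = 1) (ha : 0 < a) {z z' : ℂ}
    (h : ε * (z - z').re < 0) :
    ∫ x in Set.Ici (1 : ℝ), Complex.exp (-(ε * a * x * z')) * Complex.exp (ε * a * x * z) =
      -(ε / a) * Complex.exp (-(ε * a * z')) * Complex.exp (ε * a * z) * (z - z')⁻¹ := by
  rw [integral_Ici_eq_integral_Ioi]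
  simp only [exp_mul_exp_eq]
  rw [integral_exp_mul_complex_Ioi (rate_re_neg ha h) 1]
  have ha' : (a : ℂ) ≠ 0 := by exact_mod_cast ha.ne'
  have hε' : (ε : ℂ) ^ 2 = 1 := by exact_mod_cast hε
  have hε0 : (ε : ℂ) ≠ 0 := by
    intro h0
    rw [h0] at hε'
    norm_num at hε'
  have hz : z - z' ≠ 0 := by
    intro h0
    rw [h0] at h
    simp at h
  have h2 := exp_mul_exp_eq (ε := ε) (a := a) z z' 1
  simp only [Complex.ofReal_one, mul_one] at h2 ⊢
  rw [← h2]
  field_simp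
  linear_combination hε'

/-- The pairing on `[1, ∞)` of `exp (-ε a x p'_i)` with the integral over the imaginary axis of
`expW α t v w * exp (ε a x w) * S w`. By Fubini, the factor `S w` loses its zero at `p'_i`. -/
theorem integral_exp_mul_lineIntegral (hε : ε ^ 2 = 1) (ha : 0 < a)
    (hpU' : ∀ j, p' j ∈ halfPlane (-ε)) (hp' : Function.Injective p')
    {t : ℝ} (ht : t ∈ Set.Ioo (0 : ℝ) 1) (α v : ℝ) (i : ι') :
    IntegrableOn (fun x : ℝ => Complex.exp (-(ε * a * x * p' i)) *
      lineIntegral 0 fun w => expW α t v w * Complex.exp (ε * a * x * w) * rootProd p' w)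
      (Set.Ici 1) ∧
    resWeight p' i * ∫ x in Set.Ici (1 : ℝ), Complex.exp (-(ε * a * x * p' i)) *
      lineIntegral 0 (fun w => expW α t v w * Complex.exp (ε * a * x * w) * rootProd p' w) =
      -(ε / a) * Complex.exp (-(ε * a * p' i)) *
        gaussMoment (α + ε * a) t v (lagrangeBasis p' i) := by
  have hp0 : ∀ j, p' j ≠ 0 := fun j => ne_zero_of_mem_halfPlane (hpU' j)
  have hσ := resWeight_ne_zero hp' hp0 i
  have hline : ∀ y : ℝ, ε * ((((0 : ℝ) : ℂ) + y * Complex.I) - p' i).re < 0 := by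
    intro y
    have := hpU' i
    simp only [halfPlane, Set.mem_ofPred_eq] at this
    simpa using this
  set g : ℝ → ℂ := fun y => expW α t v ((0 : ℝ) + y * Complex.I) *
    rootProd p' ((0 : ℝ) + y * Complex.I) with hg
  have hgi : Integrable g := by
    have h := integrable_expW_mul_eval ht α v 0 (Polynomial.C (resWeight p' i)⁻¹ *
      (lagrangeBasis p' i * (Polynomial.X - Polynomial.C (p' i))))
    refine h.congr (ae_of_all _ fun y => ?_)
    simp only [hg, Polynomial.eval_mul, Polynomial.eval_sub, Polynomial.eval_C, Polynomial.eval_X]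
    rw [← resWeight_mul_rootProd hp0, inv_mul_cancel_left₀ hσ]
  have hei : Integrable (fun x : ℝ => Complex.exp (-(ε * a * x * p' i)))
      (volume.restrict (Set.Ici 1)) := by
    have := integrableOn_exp_mul_exp (ε := ε) ha (z := 0) (z' := p' i)
      (by simpa using hline 0)
    simpa [IntegrableOn] using this
  set f : ℝ → ℝ → ℂ := fun x y => Complex.exp (-(ε * a * x * p' i)) *
    (expW α t v ((0 : ℝ) + y * Complex.I) * Complex.exp (ε * a * x * ((0 : ℝ) + y * Complex.I)) *
      rootProd p' ((0 : ℝ) + y * Complex.I)) with hf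
  have hfi : Integrable (Function.uncurry f) ((volume.restrict (Set.Ici 1)).prod volume) := by
    refine (hei.mul_prod hgi).norm.mono' ?_ (ae_of_all _ fun z => ?_)
    · have h1 := continuous_expW α t v
      have h2 := (differentiable_rootProd p').continuous
      refine Continuous.aestronglyMeasurable ?_
      simp only [hf, Function.uncurry_def]
      fun_prop
    · have h1 : ‖Complex.exp (ε * a * z.1 * ((0 : ℝ) + z.2 * Complex.I))‖ = 1 := by
        have : (ε : ℂ) * a * z.1 * ((0 : ℝ) + z.2 * Complex.I) =
            ((ε * a * z.1 * z.2 : ℝ) : ℂ) * Complex.I := by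
          push_cast
          ring
        rw [this, Complex.norm_exp_ofReal_mul_I]
      simp only [hf, hg, Function.uncurry_def, norm_mul, h1, mul_one, le_refl]
  have hfx : ∀ x : ℝ, ∫ y, f x y = Complex.exp (-(ε * a * x * p' i)) * ∫ y : ℝ,
      (expW α t v ((0 : ℝ) + y * Complex.I) * Complex.exp (ε * a * x * ((0 : ℝ) + y * Complex.I)) *
      rootProd p' ((0 : ℝ) + y * Complex.I)) := fun x => integral_const_mul _ _
  constructor
  · refine ((hfi.integral_prod_left).const_mul Complex.I).congr (ae_of_all _ fun x => ?_)
    simp only [Function.uncurry_apply_pair, hfx, lineIntegral]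
    ring
  · have h1 : ∫ x in Set.Ici (1 : ℝ), Complex.exp (-(ε * a * x * p' i)) *
        lineIntegral 0 (fun w => expW α t v w * Complex.exp (ε * a * x * w) * rootProd p' w) =
        Complex.I * ∫ x in Set.Ici (1 : ℝ), ∫ y, f x y := by
      rw [← integral_const_mul]
      refine integral_congr_ae (ae_of_all _ fun x => ?_)
      simp only [hfx, lineIntegral]
      ring
    rw [h1, integral_integral_swap hfi, gaussMoment, lineIntegral, mul_left_comm]
    rw [mul_left_comm (-((ε : ℂ) / a) * Complex.exp (-(ε * a * p' i)))]
    congr 1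
    rw [← integral_const_mul, ← integral_const_mul]
    refine integral_congr_ae (ae_of_all _ fun y => ?_)
    have h2 : ∫ x in Set.Ici (1 : ℝ), f x y = g y * ∫ x in Set.Ici (1 : ℝ),
        Complex.exp (-(ε * a * x * p' i)) *
          Complex.exp (ε * a * x * ((0 : ℝ) + y * Complex.I)) := by
      rw [← integral_const_mul]
      refine integral_congr_ae (ae_of_all _ fun x => ?_)
      simp only [hf, hg]
      ring
    have hne : ((0 : ℝ) : ℂ) + y * Complex.I - p' i ≠ 0 := by
      intro h0
      have := hline y
      rw [h0] at this
      simp at this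
    simp only [h2]
    rw [integral_exp_mul_exp hε ha (hline y)]
    simp only [hg]
    have h3 := resWeight_mul_rootProd hp0 i (((0 : ℝ) : ℂ) + y * Complex.I)
    rw [expW_eq_mul (α + ε * a), expW_eq_mul α]
    have h4 : Complex.exp (((α + ε * a : ℝ) : ℂ) * ((0 : ℝ) + y * Complex.I)) =
        Complex.exp (α * ((0 : ℝ) + y * Complex.I)) *
          Complex.exp (ε * a * ((0 : ℝ) + y * Complex.I)) := by
      rw [← Complex.exp_add]
      congr 1
      push_cast
      ring
    rw [h4]
    generalize ((0 : ℝ) : ℂ) + y * Complex.I = w at h3 hne ⊢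
    have h5 : resWeight p' i * rootProd p' w * (w - p' i)⁻¹ = (lagrangeBasis p' i).eval w := by
      rw [h3, mul_inv_cancel_right₀ hne]
    rw [← h5]
    ring

end HalfLine

end IteratedIntegrals

/-! ### The ratio of Fredholm determinants -/

section Ratio

variable {ι ι' : Type*} [Fintype ι] [DecidableEq ι] [Fintype ι'] [DecidableEq ι']
  {ε a : ℝ} {p : ι → ℂ} {p' : ι' → ℂ}

/-- The matrix of the composition of interpolation at the nodes `p`, multiplication by
`exp (ε a z)`, interpolation at the nodes `p'` and multiplication by `exp (-ε a z)`, with respect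
to values at the nodes `p'`. -/
noncomputable def crossMatrix (ε a : ℝ) (p : ι → ℂ) (p' : ι' → ℂ) : Matrix ι' ι' ℂ :=
  Matrix.of fun i l => ∑ k, Complex.exp (-(ε * a * p' i)) * Complex.exp (ε * a * p k) *
    (lagrangeBasis p' i).eval (p k) * (lagrangeBasis p k).eval (p' l)

/-- The Lagrange interpolation polynomial that takes the value `r i` at `p i`. -/
noncomputable def interp (p : ι → ℂ) (r : ι → ℂ) : Polynomial ℂ :=
  ∑ i, Polynomial.C (r i) * lagrangeBasis p i

theorem interp_eq (p r : ι → ℂ) : interp p r = Lagrange.interpolate Finset.univ p r := by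
  rw [Lagrange.interpolate_apply]
  rfl

theorem degree_interp_lt (hp : Function.Injective p) (r : ι → ℂ) :
    (interp p r).degree < Fintype.card ι := by
  rw [interp_eq]
  exact Lagrange.degree_interpolate_lt r hp.injOn

theorem eval_interp_node (hp : Function.Injective p) (r : ι → ℂ) (k : ι) :
    (interp p r).eval (p k) = r k := by
  rw [interp_eq]
  exact Lagrange.eval_interpolate_at_node r hp.injOn (Finset.mem_univ k)

theorem eval_interp (r : ι → ℂ) (z : ℂ) :
    (interp p r).eval z = ∑ i, r i * (lagrangeBasis p i).eval z := by
  simp only [interp, Polynomial.eval_finsetSum, Polynomial.eval_mul, Polynomial.eval_C]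

theorem gaussMoment_interp {t : ℝ} (ht : t ∈ Set.Ioo (0 : ℝ) 1) (α v : ℝ) (r : ι → ℂ) :
    gaussMoment α t v (interp p r) = ∑ i, r i * gaussMoment α t v (lagrangeBasis p i) :=
  gaussMoment_sum ht α v _ _ _

/-- The factor of `exp (ε a z)` in the exponential polynomial `P + exp (ε a z) Q` that vanishes at
the nodes `p'`; the vector `r` consists of the values of `P` at these nodes. The polynomial `P` is
`ownFactor`. -/
noncomputable def crossFactor (ε a : ℝ) (p' : ι' → ℂ) (r : ι' → ℂ) : Polynomial ℂ :=
  interp p' fun i => -(r i * Complex.exp (-(ε * a * p' i)))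

/-- The polynomial `P` for which `P + exp (ε a z) Q` takes the values `e k` at the nodes `p k`. -/
noncomputable def ownFactor (ε a : ℝ) (p e : ι → ℂ) (Q : Polynomial ℂ) : Polynomial ℂ :=
  interp p fun k => e k - Complex.exp (ε * a * p k) * Q.eval (p k)

theorem eval_own_add_cross (hp : Function.Injective p) (e : ι → ℂ) (Q : Polynomial ℂ) (k : ι) :
    (ownFactor ε a p e Q).eval (p k) + Complex.exp (ε * a * p k) * Q.eval (p k) = e k := by
  rw [ownFactor, eval_interp_node hp, sub_add_cancel]

theorem eval_own_add_cross_eq_zero (hp' : Function.Injective p') {e : ι → ℂ} {r : ι' → ℂ}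
    (hr : Matrix.vecMul r (1 - crossMatrix ε a p p') = fun l => (interp p e).eval (p' l)) (l : ι') :
    (ownFactor ε a p e (crossFactor ε a p' r)).eval (p' l) +
      Complex.exp (ε * a * p' l) * (crossFactor ε a p' r).eval (p' l) = 0 := by
  have h1 := congrFun hr l
  rw [Matrix.vecMul_sub, Matrix.vecMul_one, Pi.sub_apply] at h1
  have h2 : Complex.exp (ε * a * p' l) * Complex.exp (-(ε * a * p' l)) = 1 := by
    rw [← Complex.exp_add, add_neg_cancel, Complex.exp_zero]
  have h3 : (ownFactor ε a p e (crossFactor ε a p' r)).eval (p' l) =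
      (interp p e).eval (p' l) + Matrix.vecMul r (crossMatrix ε a p p') l := by
    rw [ownFactor, eval_interp, eval_interp]
    simp only [crossFactor, eval_interp, Matrix.vecMul, dotProduct, crossMatrix, Matrix.of_apply,
      sub_mul, Finset.sum_sub_distrib, Finset.mul_sum, Finset.sum_mul]
    rw [sub_eq_add_neg, ← Finset.sum_neg_distrib, Finset.sum_comm (γ := ι')]
    congr 1
    refine Finset.sum_congr rfl fun k _ => ?_
    rw [← Finset.sum_neg_distrib]
    exact Finset.sum_congr rfl fun i _ => by ring
  rw [h3, crossFactor, eval_interp_node hp']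
  linear_combination -h1 - r l * h2

theorem det_one_sub_crossMatrix_ne_zero (hεa : ε * a ≠ 0) (hp : Function.Injective p)
    (hp' : Function.Injective p') (hpp' : ∀ i j, p i ≠ p' j) (hpr : ∀ k, ((p k).re : ℂ) = p k)
    (hpr' : ∀ k, ((p' k).re : ℂ) = p' k) : (1 - crossMatrix ε a p p').det ≠ 0 := by
  intro hdet
  obtain ⟨r, hr0, hr⟩ := Matrix.exists_vecMul_eq_zero_iff.2 hdet
  apply hr0
  have hr' : Matrix.vecMul r (1 - crossMatrix ε a p p') =
      fun l => (interp p (0 : ι → ℂ)).eval (p' l) := by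
    rw [hr]
    funext l
    simp [eval_interp]
  have hz : Function.Injective
      (Sum.elim (fun k => (p k).re) (fun k => (p' k).re) : ι ⊕ ι' → ℝ) := by
    rw [Sum.elim_injective]
    refine ⟨fun i j h => hp ?_, fun i j h => hp' ?_, fun i j h => hpp' i j ?_⟩
    · rw [← hpr i, ← hpr j]
      exact congrArg _ h
    · rw [← hpr' i, ← hpr' j]
      exact congrArg _ h
    · rw [← hpr i, ← hpr' j]
      exact congrArg _ h
  obtain ⟨-, hQ⟩ := expPoly_eq_zero hεa (n := Fintype.card ι) (m := Fintype.card ι')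
    (by simp) hz (P := ownFactor ε a p 0 (crossFactor ε a p' r)) (Q := crossFactor ε a p' r)
    (degree_interp_lt hp _) (degree_interp_lt hp' _) (by
      rintro (k | l)
      · simp only [Sum.elim_inl, hpr, Complex.ofReal_mul]
        exact eval_own_add_cross hp 0 _ k
      · simp only [Sum.elim_inr, hpr', Complex.ofReal_mul]
        exact eval_own_add_cross_eq_zero hp' hr' l)
  funext l
  have h := eval_interp_node hp' (fun i => -(r i * Complex.exp (-(ε * a * p' i)))) l
  rw [← crossFactor, hQ, Polynomial.eval_zero, eq_comm, neg_eq_zero] at h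
  exact (mul_eq_zero.1 h).resolve_right (Complex.exp_ne_zero _)

/-- The functions of `y` in the expansions of finite rank. The factor `resWeight p' l` is put here,
and not into the functions of `x`, so that the pairings with `kernelFun` are exactly the entries of
`crossMatrix`. -/
noncomputable def dualFun (ε a : ℝ) (p' : ι' → ℂ) (l : ι') (y : ℝ) : ℂ :=
  resWeight p' l * Complex.exp (-(ε * a * y * p' l))

/-- The functions of `x` in the expansion of finite rank of the kernels `M₀` and `M̂₀`. -/
noncomputable def kernelFun (ε a : ℝ) (p : ι → ℂ) (p' : ι' → ℂ) (l : ι') (x : ℝ) : ℂ :=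
  ∑ k, -(a * ε) * rootProd p' (p k) * (lagrangeBasis p k).eval (p' l) *
    Complex.exp (ε * a * x * p k)

/-- The functions `𝓑 + β` and `𝓑̂ + β̂`, up to a constant factor. -/
noncomputable def columnFun (ε a : ℝ) (p : ι → ℂ) (p' : ι' → ℂ) (α t v x : ℝ) : ℂ :=
  lineIntegral 0 (fun w => expW α t v w * Complex.exp (ε * a * x * w) * rootProd p' w) -
    ∑ k, rootProd p' (p k) * gaussMoment α t v (lagrangeBasis p k) * Complex.exp (ε * a * x * p k)

theorem halfPlane_sub_re_neg {z z' : ℂ} (hz : z ∈ halfPlane ε) (hz' : z' ∈ halfPlane (-ε)) :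
    ε * (z - z').re < 0 := by
  simp only [halfPlane, Set.mem_ofPred_eq] at hz hz'
  rw [Complex.sub_re]
  linarith

omit [Fintype ι] [DecidableEq ι] in
theorem integrableOn_dualFun_mul_exp (ha : 0 < a) (hpU : ∀ j, p j ∈ halfPlane ε)
    (hpU' : ∀ j, p' j ∈ halfPlane (-ε)) (i : ι') (k : ι) (c : ℂ) :
    IntegrableOn (fun x => dualFun ε a p' i x * (c * Complex.exp (ε * a * x * p k)))
      (Set.Ici 1) := by
  have h := (integrableOn_exp_mul_exp ha (halfPlane_sub_re_neg (hpU k) (hpU' i))).const_mul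
    (resWeight p' i * c)
  refine h.congr (ae_of_all _ fun x => ?_)
  simp only [dualFun]
  ring

omit [Fintype ι] [DecidableEq ι] in
theorem integral_dualFun_mul_exp (hε : ε ^ 2 = 1) (ha : 0 < a) (hpU : ∀ j, p j ∈ halfPlane ε)
    (hpU' : ∀ j, p' j ∈ halfPlane (-ε)) (i : ι') (k : ι) (c : ℂ) :
    ∫ x in Set.Ici (1 : ℝ), dualFun ε a p' i x *
      (c * rootProd p' (p k) * Complex.exp (ε * a * x * p k)) =
      -(c * (ε / a) * Complex.exp (-(ε * a * p' i)) * Complex.exp (ε * a * p k) *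
        (lagrangeBasis p' i).eval (p k)) := by
  have h1 : ∫ x in Set.Ici (1 : ℝ), dualFun ε a p' i x *
      (c * rootProd p' (p k) * Complex.exp (ε * a * x * p k)) =
      resWeight p' i * (c * rootProd p' (p k)) * ∫ x in Set.Ici (1 : ℝ),
        Complex.exp (-(ε * a * x * p' i)) * Complex.exp (ε * a * x * p k) := by
    rw [← integral_const_mul]
    refine integral_congr_ae (ae_of_all _ fun x => ?_)
    simp only [dualFun]
    ring
  rw [h1, integral_exp_mul_exp hε ha (halfPlane_sub_re_neg (hpU k) (hpU' i))]
  have h2 := resWeight_mul_rootProd (fun j => ne_zero_of_mem_halfPlane (hpU' j)) i (p k)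
  have h3 : p k - p' i ≠ 0 := sub_ne_zero.2 (ne_of_mem_halfPlane (hpU k) (hpU' i))
  have h4 : resWeight p' i * rootProd p' (p k) * (p k - p' i)⁻¹ =
      (lagrangeBasis p' i).eval (p k) := by
    rw [h2, mul_inv_cancel_right₀ h3]
  rw [← h4]
  ring

theorem dualFun_kernelFun (hε : ε ^ 2 = 1) (ha : 0 < a) (hpU : ∀ j, p j ∈ halfPlane ε)
    (hpU' : ∀ j, p' j ∈ halfPlane (-ε)) (i l : ι') :
    IntegrableOn (fun x => dualFun ε a p' i x * kernelFun ε a p p' l x) (Set.Ici 1) ∧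
    ∫ x in Set.Ici (1 : ℝ), dualFun ε a p' i x * kernelFun ε a p p' l x =
      crossMatrix ε a p p' i l := by
  have hi : ∀ k, IntegrableOn (fun x => dualFun ε a p' i x *
      (-(a * ε) * rootProd p' (p k) * (lagrangeBasis p k).eval (p' l) *
        Complex.exp (ε * a * x * p k))) (Set.Ici 1) :=
    fun k => integrableOn_dualFun_mul_exp ha hpU hpU' i k _
  simp only [kernelFun, Finset.mul_sum]
  refine ⟨integrable_finsetSum _ fun k _ => hi k, ?_⟩
  rw [integral_finsetSum _ fun k _ => hi k, crossMatrix, Matrix.of_apply]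
  refine Finset.sum_congr rfl fun k _ => ?_
  have h := integral_dualFun_mul_exp hε ha hpU hpU' i k
    (-(a * ε) * (lagrangeBasis p k).eval (p' l))
  have ha' : (a : ℂ) ≠ 0 := by exact_mod_cast ha.ne'
  have hε' : (ε : ℂ) ^ 2 = 1 := by exact_mod_cast hε
  have hc : ∀ X : ℂ, -(-((a : ℂ) * ε) * X * (ε / a)) = X := by
    intro X
    field_simp
    linear_combination X * hε'
  simp only [mul_right_comm _ (rootProd p' (p k))]
  simp only [mul_right_comm _ (rootProd p' (p k))] at h
  rw [h]
  linear_combination (Complex.exp (-(ε * a * p' i)) * Complex.exp (ε * a * p k) *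
    (lagrangeBasis p' i).eval (p k)) * hc ((lagrangeBasis p k).eval (p' l))

theorem dualFun_columnFun (hε : ε ^ 2 = 1) (ha : 0 < a) (hpU : ∀ j, p j ∈ halfPlane ε)
    (hpU' : ∀ j, p' j ∈ halfPlane (-ε)) (hp' : Function.Injective p')
    {t : ℝ} (ht : t ∈ Set.Ioo (0 : ℝ) 1) (α v : ℝ) (i : ι') :
    IntegrableOn (fun x => dualFun ε a p' i x * columnFun ε a p p' α t v x) (Set.Ici 1) ∧
    ∫ x in Set.Ici (1 : ℝ), dualFun ε a p' i x * columnFun ε a p p' α t v x =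
      ε / a * (Complex.exp (-(ε * a * p' i)) *
        (∑ k, Complex.exp (ε * a * p k) * (lagrangeBasis p' i).eval (p k) *
          gaussMoment α t v (lagrangeBasis p k) -
        gaussMoment (α + ε * a) t v (lagrangeBasis p' i))) := by
  obtain ⟨h1, h2⟩ := integral_exp_mul_lineIntegral hε ha hpU' hp' ht α v i
  have hi : ∀ k, IntegrableOn (fun x => dualFun ε a p' i x *
      (rootProd p' (p k) * gaussMoment α t v (lagrangeBasis p k) *
        Complex.exp (ε * a * x * p k))) (Set.Ici 1) :=
    fun k => integrableOn_dualFun_mul_exp ha hpU hpU' i k _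
  have hi' := integrable_finsetSum Finset.univ fun k (_ : k ∈ Finset.univ) => hi k
  have h3 := h1.const_mul (resWeight p' i)
  have heq : ∀ x, dualFun ε a p' i x * columnFun ε a p p' α t v x =
      resWeight p' i * (Complex.exp (-(ε * a * x * p' i)) * lineIntegral 0 fun w =>
        expW α t v w * Complex.exp (ε * a * x * w) * rootProd p' w) -
      ∑ k, dualFun ε a p' i x * (rootProd p' (p k) * gaussMoment α t v (lagrangeBasis p k) *
        Complex.exp (ε * a * x * p k)) := by
    intro x
    rw [columnFun, mul_sub, Finset.mul_sum, dualFun, mul_assoc]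
  simp only [heq]
  refine ⟨h3.sub hi', ?_⟩
  rw [integral_sub h3 hi', integral_const_mul, h2, integral_finsetSum _ fun k _ => hi k]
  have h4 : ∀ k, ∫ x in Set.Ici (1 : ℝ), dualFun ε a p' i x *
      (rootProd p' (p k) * gaussMoment α t v (lagrangeBasis p k) *
        Complex.exp (ε * a * x * p k)) =
      -(ε / a * (Complex.exp (-(ε * a * p' i)) * (Complex.exp (ε * a * p k) *
        (lagrangeBasis p' i).eval (p k) * gaussMoment α t v (lagrangeBasis p k)))) := by
    intro k
    have h := integral_dualFun_mul_exp hε ha hpU hpU' i k (gaussMoment α t v (lagrangeBasis p k))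
    simp only [mul_comm (rootProd p' (p k))]
    rw [h]
    ring
  simp only [h4]
  rw [Finset.sum_neg_distrib, ← Finset.mul_sum, ← Finset.mul_sum]
  ring

/-- The ratio of Fredholm determinants is `1` plus a Gaussian moment of the exponential polynomial
`P + exp (ε a z) Q` that takes the values `e k` at `p k` and vanishes at the `p' l`, from which the
polynomial that interpolates the `e k` is subtracted. -/
theorem fredholmDet_ratio (hε : ε ^ 2 = 1) (ha : 0 < a) (hpU : ∀ j, p j ∈ halfPlane ε)
    (hpU' : ∀ j, p' j ∈ halfPlane (-ε)) (hp : Function.Injective p) (hp' : Function.Injective p')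
    (hpr : ∀ k, ((p k).re : ℂ) = p k) (hpr' : ∀ k, ((p' k).re : ℂ) = p' k)
    {t : ℝ} (ht : t ∈ Set.Ioo (0 : ℝ) 1) (α v : ℝ) (e : ι → ℂ) {κ κ' : ℂ}
    {M : ℝ → ℝ → ℂ} {b g : ℝ → ℂ}
    (hM : ∀ x y, M x y = ∑ l, kernelFun ε a p p' l x * dualFun ε a p' l y)
    (hb : ∀ x, b x = κ * columnFun ε a p p' α t v x)
    (hg : ∀ y, g y = κ' * ∑ l, (interp p e).eval (p' l) * dualFun ε a p' l y) :
    fredholmDet (Set.Ici 1) (fun x y => -M x y) ≠ 0 ∧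
    ∃ P Q : Polynomial ℂ, P.degree < Fintype.card ι ∧ Q.degree < Fintype.card ι' ∧
      (∀ k, P.eval (p k) + Complex.exp (ε * a * p k) * Q.eval (p k) = e k) ∧
      (∀ l, P.eval (p' l) + Complex.exp (ε * a * p' l) * Q.eval (p' l) = 0) ∧
      fredholmDet (Set.Ici 1) (fun x y => -M x y + b x * g y) /
        fredholmDet (Set.Ici 1) (fun x y => -M x y) - 1 =
        κ * κ' * (ε / a) * (gaussMoment α t v P + gaussMoment (α + ε * a) t v Q -
          gaussMoment α t v (interp p e)) := by
  set Y := crossMatrix ε a p p' with hY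
  have hε0 : ε ≠ 0 := by
    rintro rfl
    norm_num at hε
  have hdet : (1 - Y).det ≠ 0 := det_one_sub_crossMatrix_ne_zero (mul_ne_zero hε0 ha.ne') hp hp'
    (fun i j => ne_of_mem_halfPlane (hpU i) (hpU' j)) hpr hpr'
  set G : ι' → ℂ := fun i => ∫ x in Set.Ici (1 : ℝ), dualFun ε a p' i x *
    columnFun ε a p p' α t v x with hG
  have hdet0 : fredholmDet (Set.Ici 1) (fun x y => -M x y) = (1 - Y).det := by
    have h1 : (fun x y => -M x y) =
        fun x y => ∑ l, -kernelFun ε a p p' l x * dualFun ε a p' l y := by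
      funext x y
      rw [hM, ← Finset.sum_neg_distrib]
      exact Finset.sum_congr rfl fun l _ => by ring
    rw [h1, fredholmDet_finite_rank]
    · congr 1
      rw [sub_eq_add_neg]
      congr 1
      ext i l
      simp only [Matrix.of_apply, mul_neg, integral_neg, Matrix.neg_apply,
        (dualFun_kernelFun hε ha hpU hpU' i l).2, hY]
    · intro i l
      simp only [mul_neg]
      exact (dualFun_kernelFun hε ha hpU hpU' i l).1.neg
  have hdet1 : fredholmDet (Set.Ici 1) (fun x y => -M x y + b x * g y) =
      ((1 - Y) + Matrix.replicateCol Unit G *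
        Matrix.replicateRow Unit fun l => κ * κ' * (interp p e).eval (p' l)).det := by
    have h1 : (fun x y => -M x y + b x * g y) =
        fun x y => ∑ l, (-kernelFun ε a p p' l x + κ * κ' * (interp p e).eval (p' l) *
          columnFun ε a p p' α t v x) * dualFun ε a p' l y := by
      funext x y
      rw [hM, hb, hg, ← Finset.sum_neg_distrib, Finset.mul_sum, Finset.mul_sum,
        ← Finset.sum_add_distrib]
      exact Finset.sum_congr rfl fun l _ => by ring
    have h2 : ∀ i l x, dualFun ε a p' i x * (-kernelFun ε a p p' l x +
        κ * κ' * (interp p e).eval (p' l) * columnFun ε a p p' α t v x) =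
        -(dualFun ε a p' i x * kernelFun ε a p p' l x) +
          κ * κ' * (interp p e).eval (p' l) *
            (dualFun ε a p' i x * columnFun ε a p p' α t v x) := fun i l x => by ring
    have hi1 : ∀ i l, IntegrableOn (fun x => -(dualFun ε a p' i x * kernelFun ε a p p' l x))
        (Set.Ici 1) := fun i l => (dualFun_kernelFun hε ha hpU hpU' i l).1.neg
    have hi2 := fun i l => (dualFun_columnFun hε ha hpU hpU' hp' ht α v i).1.const_mul
      (κ * κ' * (interp p e).eval (p' l))
    rw [h1, fredholmDet_finite_rank]
    · congr 1
      rw [sub_eq_add_neg, add_assoc]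
      congr 1
      ext i l
      simp only [Matrix.of_apply, h2]
      rw [integral_add (hi1 i l) (hi2 i l), integral_neg, integral_const_mul,
        (dualFun_kernelFun hε ha hpU hpU' i l).2]
      simp only [Matrix.add_apply, Matrix.neg_apply, Matrix.mul_apply, Matrix.replicateCol_apply,
        Matrix.replicateRow_apply, Finset.univ_unique, Finset.sum_singleton, hG, hY]
      ring
    · intro i l
      simp only [h2]
      exact (hi1 i l).add (hi2 i l)
  refine ⟨hdet0 ▸ hdet, ?_⟩
  set r : ι' → ℂ := Matrix.vecMul (fun l => (interp p e).eval (p' l)) (1 - Y)⁻¹ with hr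
  have hrY : Matrix.vecMul r (1 - Y) = fun l => (interp p e).eval (p' l) := by
    rw [hr, Matrix.vecMul_vecMul, Matrix.nonsing_inv_mul _ (isUnit_iff_ne_zero.2 hdet),
      Matrix.vecMul_one]
  refine ⟨ownFactor ε a p e (crossFactor ε a p' r), crossFactor ε a p' r, degree_interp_lt hp _,
    degree_interp_lt hp' _, eval_own_add_cross hp e _, eval_own_add_cross_eq_zero hp' hrY, ?_⟩
  have hratio : fredholmDet (Set.Ici 1) (fun x y => -M x y + b x * g y) /
      fredholmDet (Set.Ici 1) (fun x y => -M x y) - 1 = κ * κ' * ∑ i, r i * G i := by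
    rw [hdet0, hdet1, Matrix.det_add_replicateCol_mul_replicateRow (isUnit_iff_ne_zero.2 hdet),
      mul_div_cancel_left₀ _ hdet, Matrix.det_unique, Matrix.add_apply, Matrix.one_apply_eq,
      add_sub_cancel_left, Matrix.mul_apply, Finset.mul_sum]
    refine Finset.sum_congr rfl fun i _ => ?_
    simp only [Matrix.mul_apply, Matrix.replicateCol_apply, Matrix.replicateRow_apply, hr,
      Matrix.vecMul, dotProduct, Finset.sum_mul, Finset.mul_sum]
    exact Finset.sum_congr rfl fun l _ => by ring
  rw [hratio, mul_assoc (κ * κ')]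
  congr 1
  rw [ownFactor, gaussMoment_interp ht, gaussMoment_interp ht, crossFactor, gaussMoment_interp ht]
  have hG' := fun i => (dualFun_columnFun hε ha hpU hpU' hp' ht α v i).2
  simp only [hG, hG', eval_interp]
  set J := fun k => gaussMoment α t v (lagrangeBasis p k)
  set J' := fun i => gaussMoment (α + ε * a) t v (lagrangeBasis p' i)
  set E := fun i => Complex.exp (-(ε * a * p' i))
  set X := fun k => Complex.exp (ε * a * p k)
  have hswap : ∑ k, X k * (∑ i, -(r i * E i) * (lagrangeBasis p' i).eval (p k)) * J k =
      -∑ i, r i * E i * ∑ k, X k * (lagrangeBasis p' i).eval (p k) * J k := by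
    simp only [Finset.mul_sum, Finset.sum_mul]
    rw [Finset.sum_comm, ← Finset.sum_neg_distrib]
    refine Finset.sum_congr rfl fun i _ => ?_
    rw [← Finset.sum_neg_distrib]
    exact Finset.sum_congr rfl fun k _ => by ring
  have hleft : ∑ i, r i * (ε / a * (E i *
      (∑ k, X k * (lagrangeBasis p' i).eval (p k) * J k - J' i))) =
      ε / a * (∑ i, r i * E i * ∑ k, X k * (lagrangeBasis p' i).eval (p k) * J k +
        ∑ i, -(r i * E i) * J' i) := by
    rw [← Finset.sum_add_distrib, Finset.mul_sum]
    exact Finset.sum_congr rfl fun i _ => by ring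
  have hright : ∑ k, (e k - X k * ∑ i, -(r i * E i) * (lagrangeBasis p' i).eval (p k)) * J k =
      ∑ k, e k * J k -
        ∑ k, X k * (∑ i, -(r i * E i) * (lagrangeBasis p' i).eval (p k)) * J k := by
    rw [← Finset.sum_sub_distrib]
    exact Finset.sum_congr rfl fun k _ => by ring
  rw [hleft, hright, hswap]
  ring

end Ratio

/-! ### The two halves of the limiting kernel -/

section Halves

variable {ι ι' : Type*} [Fintype ι] [DecidableEq ι] [Fintype ι'] [DecidableEq ι']
  {γ γ' : ℝ → ℂ} {ε a : ℝ} {p : ι → ℂ} {p' : ι' → ℂ}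

theorem resWeight_mul_rootProd_div (hp0 : ∀ j, p j ≠ 0) (k : ι) {w : ℂ} (hw : w ≠ p k) :
    resWeight p k * rootProd p w * (w - p k)⁻¹ = (lagrangeBasis p k).eval w := by
  rw [resWeight_mul_rootProd hp0, mul_inv_cancel_right₀ (sub_ne_zero.2 hw)]

theorem differentiable_expZ (α s u : ℝ) : Differentiable ℂ (expZ α s u) := by
  unfold expZ
  fun_prop

theorem differentiableOn_inv_sub_left {z : ℂ} (hz : z ∈ halfPlane ε) :
    DifferentiableOn ℂ (fun w => (z - w)⁻¹) (halfPlane (-ε)) :=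
  (differentiableOn_id.const_sub z).inv fun _ hw => sub_ne_zero.2 (ne_of_mem_halfPlane hz hw)

theorem differentiableOn_inv_sub_right {w : ℂ} (hw : w ∈ halfPlane (-ε)) :
    DifferentiableOn ℂ (fun z => (z - w)⁻¹) (halfPlane ε) :=
  (differentiableOn_id.sub_const w).inv fun _ hz => sub_ne_zero.2 (ne_of_mem_halfPlane hz hw)

/-- The common form of `M₀` and `MHat₀` is a kernel of finite rank. -/
theorem contour_kernel_eq (hε : ε ^ 2 = 1)
    (hγ : IsContour γ (halfPlane ε) p) (hγ' : IsContour γ' (halfPlane (-ε)) p')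
    (hp : Function.Injective p) (hp' : Function.Injective p')
    (hpU : ∀ j, p j ∈ halfPlane ε) (hpU' : ∀ j, p' j ∈ halfPlane (-ε)) (x y : ℝ) :
    (a : ℂ) / (2 * (Real.pi : ℂ) * Complex.I) ^ 2 *
      contourIntegral γ (fun ζ => contourIntegral γ' fun ω =>
        (Complex.exp (ε * a * x * ζ) * Complex.exp (-(ε * a * y * ω)) * ε * (ζ - ω)⁻¹ *
          rootProd p ω * rootProd p' ζ) * (rootProd p ζ)⁻¹ * (rootProd p' ω)⁻¹) =
      ∑ l, kernelFun ε a p p' l x * dualFun ε a p' l y := by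
  have hR := differentiable_rootProd p
  have hS := differentiable_rootProd p'
  rw [contourIntegral_residue_residue hε hγ hγ' hp hp' hpU hpU' (G := fun ζ ω =>
    Complex.exp (ε * a * x * ζ) * Complex.exp (-(ε * a * y * ω)) * ε * (ζ - ω)⁻¹ *
      rootProd p ω * rootProd p' ζ)]
  · rw [← mul_assoc, div_mul_cancel₀ _ (pow_ne_zero 2 Complex.two_pi_I_ne_zero), Finset.mul_sum]
    refine Finset.sum_congr rfl fun l _ => ?_
    rw [kernelFun, Finset.mul_sum, Finset.sum_mul]
    refine Finset.sum_congr rfl fun k _ => ?_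
    have h := resWeight_mul_rootProd_div (fun j => ne_zero_of_mem_halfPlane (hpU j)) k
      (ne_of_mem_halfPlane (hpU k) (hpU' l)).symm
    rw [← h, dualFun, ← neg_sub (p k) (p' l), inv_neg]
    ring
  · intro ζ hζ
    have h1 := differentiableOn_inv_sub_left hζ
    have h2 := hR.differentiableOn (s := halfPlane (-ε))
    fun_prop
  · intro ω hω
    have h1 := differentiableOn_inv_sub_right hω
    have h2 := hS.differentiableOn (s := halfPlane ε)
    fun_prop

/-- The common form of `C` and `CHat`. -/
theorem contour_row_eq (hε : ε ^ 2 = 1)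
    (hγ : IsContour γ (halfPlane ε) p) (hγ' : IsContour γ' (halfPlane (-ε)) p')
    (hp : Function.Injective p) (hp' : Function.Injective p')
    (hpU : ∀ j, p j ∈ halfPlane ε) (hpU' : ∀ j, p' j ∈ halfPlane (-ε)) {F : ℂ → ℂ}
    (hF : Differentiable ℂ F) (y : ℝ) :
    contourIntegral γ (fun z => contourIntegral γ' fun ω =>
        (F z * rootProd p ω * Complex.exp (-(ε * a * y * ω)) * ε * (ω - z)⁻¹) *
          (rootProd p z)⁻¹ * (rootProd p' ω)⁻¹) =
      (2 * (Real.pi : ℂ) * Complex.I) ^ 2 * (ε *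
        ∑ l, (interp p fun k => F (p k)).eval (p' l) * dualFun ε a p' l y) := by
  have hR := differentiable_rootProd p
  rw [contourIntegral_residue_residue hε hγ hγ' hp hp' hpU hpU' (G := fun z ω =>
    F z * rootProd p ω * Complex.exp (-(ε * a * y * ω)) * ε * (ω - z)⁻¹)]
  · congr 1
    rw [Finset.mul_sum]
    refine Finset.sum_congr rfl fun l _ => ?_
    rw [eval_interp, Finset.sum_mul, Finset.mul_sum]
    refine Finset.sum_congr rfl fun k _ => ?_
    have h := resWeight_mul_rootProd_div (fun j => ne_zero_of_mem_halfPlane (hpU j)) k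
      (ne_of_mem_halfPlane (hpU k) (hpU' l)).symm
    rw [← h, dualFun]
    ring
  · intro z hz
    have h1 : DifferentiableOn ℂ (fun w => (w - z)⁻¹) (halfPlane (-ε)) :=
      differentiableOn_inv_sub_right (by rwa [neg_neg])
    have h2 := hR.differentiableOn (s := halfPlane (-ε))
    fun_prop
  · intro ω hω
    have h1 : DifferentiableOn ℂ (fun z => (ω - z)⁻¹) (halfPlane ε) := by
      have := differentiableOn_inv_sub_left hω
      rwa [neg_neg] at this
    have h2 := hF.differentiableOn (s := halfPlane ε)
    fun_prop

/-- One half of the limiting kernel, computed from an interpolating exponential polynomial. The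
case `ε = 1` is `L` and the case `ε = -1` is `LHat`; the sign `δ` accounts for the different
normalizations of the products in `βHat` and `CHat`. -/
theorem exists_interpolating_expPoly (hε : ε ^ 2 = 1) (ha : 0 < a)
    (hγ : IsContour γ (halfPlane ε) p) (hγ' : IsContour γ' (halfPlane (-ε)) p')
    (hp : Function.Injective p) (hp' : Function.Injective p')
    (hpU : ∀ j, p j ∈ halfPlane ε) (hpU' : ∀ j, p' j ∈ halfPlane (-ε))
    (hpr : ∀ k, ((p k).re : ℂ) = p k) (hpr' : ∀ k, ((p' k).re : ℂ) = p' k)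
    {s t : ℝ} (hs : s ∈ Set.Ioo (0 : ℝ) 1) (ht : t ∈ Set.Ioo (0 : ℝ) 1) (α u v : ℝ)
    {c : ℝ} (hc : 0 ≤ ε * c) {d₁ d₂ δ : ℂ} (hd₁ : d₁ ≠ 0) (hd₂ : d₂ ≠ 0) (hδ : δ ^ 2 = 1)
    {M : ℝ → ℝ → ℂ} {b g : ℝ → ℂ} {D : ℂ}
    (hM : ∀ x y, M x y = (a : ℂ) / (2 * (Real.pi : ℂ) * Complex.I) ^ 2 *
      contourIntegral γ (fun ζ => contourIntegral γ' fun ω =>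
        (Complex.exp (ε * a * x * ζ) * Complex.exp (-(ε * a * y * ω)) * ε * (ζ - ω)⁻¹ *
          rootProd p ω * rootProd p' ζ) * (rootProd p ζ)⁻¹ * (rootProd p' ω)⁻¹))
    (hb : ∀ x, b x = d₂ * (Real.sqrt a : ℂ) /
          ((2 * (Real.pi : ℂ) * Complex.I) ^ 2 * (Real.sqrt (1 - t) : ℂ)) *
        lineIntegral c (fun w => contourIntegral γ fun ζ => expW α t v w *
          (δ * (rootProd p' ζ * Complex.exp (ε * a * x * ζ)) * (ζ - w)⁻¹ * rootProd p w *
            (rootProd p ζ)⁻¹)) +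
      d₂ * (Real.sqrt a : ℂ) / (2 * (Real.pi : ℂ) * Complex.I * (Real.sqrt (1 - t) : ℂ)) *
        lineIntegral 0 fun w => δ *
          (expW α t v w * Complex.exp (ε * a * x * w) * rootProd p' w))
    (hg : ∀ y, g y = d₁ * (Real.sqrt a : ℂ) /
          ((2 * (Real.pi : ℂ) * Complex.I) ^ 2 * (Real.sqrt (1 - s) : ℂ)) *
        contourIntegral γ fun z => contourIntegral γ' fun ω =>
          ((δ * expZ α s u z) * rootProd p ω * Complex.exp (-(ε * a * y * ω)) * ε * (ω - z)⁻¹) *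
          (rootProd p z)⁻¹ * (rootProd p' ω)⁻¹)
    (hD : D = lineIntegral 0 fun w => contourIntegral γ fun z => expW α t v w *
      ((-expZ α s u z) * (z - w)⁻¹ * rootProd p w * (rootProd p z)⁻¹)) :
    fredholmDet (Set.Ici 1) (fun x y => -M x y) ≠ 0 ∧
    ∃ P Q : Polynomial ℂ, P.degree < Fintype.card ι ∧ Q.degree < Fintype.card ι' ∧
      (∀ k, P.eval (p k) + Complex.exp (ε * a * p k) * Q.eval (p k) = expZ α s u (p k)) ∧
      (∀ l, P.eval (p' l) + Complex.exp (ε * a * p' l) * Q.eval (p' l) = 0) ∧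
      (d₁ * d₂)⁻¹ * (d₁ * d₂ / ((2 * (Real.pi : ℂ) * Complex.I) ^ 2 *
          (Real.sqrt ((1 - s) * (1 - t)) : ℂ)) * D +
        fredholmDet (Set.Ici 1) (fun x y => -M x y + b x * g y) /
          fredholmDet (Set.Ici 1) (fun x y => -M x y) - 1) =
        (2 * (Real.pi : ℂ) * Complex.I * (Real.sqrt ((1 - s) * (1 - t)) : ℂ))⁻¹ *
          (gaussMoment α t v P + gaussMoment (α + ε * a) t v Q) := by
  have hpi := Complex.two_pi_I_ne_zero
  have hs1 : 0 < 1 - s := sub_pos.2 hs.2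
  have ht1 : 0 < 1 - t := sub_pos.2 ht.2
  have hss : (Real.sqrt (1 - s) : ℂ) ≠ 0 := by exact_mod_cast (Real.sqrt_pos.2 hs1).ne'
  have hst : (Real.sqrt (1 - t) : ℂ) ≠ 0 := by exact_mod_cast (Real.sqrt_pos.2 ht1).ne'
  have ha0 : (a : ℂ) ≠ 0 := by exact_mod_cast ha.ne'
  have hsa : (Real.sqrt a : ℂ) ^ 2 = a := by exact_mod_cast Real.sq_sqrt ha.le
  have hε' : (ε : ℂ) ^ 2 = 1 := by exact_mod_cast hε
  have hsq : (Real.sqrt ((1 - s) * (1 - t)) : ℂ) = Real.sqrt (1 - s) * Real.sqrt (1 - t) := by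
    rw [Real.sqrt_mul hs1.le, Complex.ofReal_mul]
  have hb' : ∀ x, b x = (δ * d₂ * (Real.sqrt a : ℂ) /
      (2 * (Real.pi : ℂ) * Complex.I * (Real.sqrt (1 - t) : ℂ))) *
        columnFun ε a p p' α t v x := by
    intro x
    have hF : DifferentiableOn ℂ
        (fun ζ => δ * (rootProd p' ζ * Complex.exp (ε * a * x * ζ))) (halfPlane ε) := by
      have h2 := (differentiable_rootProd p').differentiableOn (s := halfPlane ε)
      fun_prop
    rw [hb, lineIntegral_contourIntegral hε hγ hp hpU hF hc ht, lineIntegral_const_mul, columnFun]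
    have h1 : ∑ k, δ * (rootProd p' (p k) * Complex.exp (ε * a * x * p k)) *
        gaussMoment α t v (lagrangeBasis p k) =
        δ * ∑ k, rootProd p' (p k) * gaussMoment α t v (lagrangeBasis p k) *
          Complex.exp (ε * a * x * p k) := by
      rw [Finset.mul_sum]
      exact Finset.sum_congr rfl fun k _ => by ring
    rw [h1]
    generalize 2 * (Real.pi : ℂ) * Complex.I = τ at hpi ⊢
    field_simp
    ring
  have hg' : ∀ y, g y = (d₁ * (Real.sqrt a : ℂ) / (Real.sqrt (1 - s) : ℂ) * δ * ε) *
      ∑ l, (interp p fun k => expZ α s u (p k)).eval (p' l) * dualFun ε a p' l y := by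
    intro y
    rw [hg, contour_row_eq hε hγ hγ' hp hp' hpU hpU' ((differentiable_expZ α s u).const_mul δ)]
    have h1 : ∀ l, (interp p fun k => δ * expZ α s u (p k)).eval (p' l) =
        δ * (interp p fun k => expZ α s u (p k)).eval (p' l) := by
      intro l
      simp only [eval_interp, Finset.mul_sum, mul_assoc]
    simp only [h1, mul_assoc δ]
    rw [← Finset.mul_sum]
    generalize 2 * (Real.pi : ℂ) * Complex.I = τ at hpi ⊢
    field_simp
  obtain ⟨hne, P, Q, hP, hQ, h0, h0', hrat⟩ := fredholmDet_ratio hε ha hpU hpU' hp hp' hpr hpr' ht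
    α v (fun k => expZ α s u (p k))
    (fun x y => (hM x y).trans (contour_kernel_eq hε hγ hγ' hp hp' hpU hpU' x y)) hb' hg'
  refine ⟨hne, P, Q, hP, hQ, h0, h0', ?_⟩
  have hD' : D = 2 * (Real.pi : ℂ) * Complex.I *
      gaussMoment α t v (interp p fun k => expZ α s u (p k)) := by
    rw [hD, lineIntegral_contourIntegral hε hγ hp hpU (F := fun z => -expZ α s u z)
      (differentiable_expZ α s u).neg.differentiableOn (by simp) ht, gaussMoment_interp ht]
    simp only [neg_mul, Finset.sum_neg_distrib, mul_neg, neg_neg]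
  have hcoef : δ * d₂ * (Real.sqrt a : ℂ) /
        (2 * (Real.pi : ℂ) * Complex.I * (Real.sqrt (1 - t) : ℂ)) *
      (d₁ * (Real.sqrt a : ℂ) / (Real.sqrt (1 - s) : ℂ) * δ * ε) * (ε / a) =
      d₁ * d₂ * (2 * (Real.pi : ℂ) * Complex.I *
        (Real.sqrt (1 - s) * Real.sqrt (1 - t)))⁻¹ := by
    have hkey : δ ^ 2 * (Real.sqrt a : ℂ) ^ 2 * (ε : ℂ) ^ 2 = a := by
      rw [hδ, hε', hsa]
      ring
    generalize 2 * (Real.pi : ℂ) * Complex.I = τ at hpi ⊢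
    field_simp
    linear_combination hkey
  rw [add_sub_assoc, hrat, hcoef, hD', hsq]
  generalize 2 * (Real.pi : ℂ) * Complex.I = τ at hpi ⊢
  field_simp
  ring

omit [DecidableEq ι] in
theorem prod_one_sub_div (p : ι → ℂ) (w z : ℂ) :
    ∏ j, (1 - w / p j) / (1 - z / p j) = rootProd p w * (rootProd p z)⁻¹ := by
  rw [Finset.prod_div_distrib, div_eq_mul_inv, rootProd, rootProd]

omit [DecidableEq ι] in
theorem prod_sub_one_div (p : ι → ℂ) (w z : ℂ) :
    ∏ j, (w / p j - 1) / (z / p j - 1) = rootProd p w * (rootProd p z)⁻¹ := by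
  rw [← prod_one_sub_div]
  exact Finset.prod_congr rfl fun j _ => by
    rw [← neg_sub 1 (w / p j), ← neg_sub 1 (z / p j), neg_div_neg_eq]

omit [DecidableEq ι] in
theorem prod_one_div_one_sub (p : ι → ℂ) (z : ℂ) :
    ∏ j, 1 / (1 - z / p j) = (rootProd p z)⁻¹ := by
  simp only [one_div, Finset.prod_inv_distrib, rootProd]

omit [DecidableEq ι] in
theorem prod_sub_one (p : ι → ℂ) (z : ℂ) :
    ∏ j, (z / p j - 1) = (-1) ^ Fintype.card ι * rootProd p z := by
  rw [rootProd, ← Finset.card_univ, ← Finset.prod_const, ← Finset.prod_mul_distrib]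
  exact Finset.prod_congr rfl fun j _ => by ring

omit [DecidableEq ι] in
theorem prod_one_div_sub_one (p : ι → ℂ) (z : ℂ) :
    ∏ j, 1 / (z / p j - 1) = (-1) ^ Fintype.card ι * (rootProd p z)⁻¹ := by
  simp only [one_div, Finset.prod_inv_distrib]
  rw [prod_sub_one, mul_inv]
  congr 1
  rw [← inv_pow]
  norm_num

end Halves

section Instances

variable {n m : ℕ} {a₁ a₂ : ℝ} {ν : Fin (n + m) → ℝ} {γ₁ γ₂ : ℝ → ℂ} {s t : ℝ}

theorem halfPlane_one : halfPlane 1 = {z : ℂ | z.re < 0} := by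
  ext z
  simp [halfPlane]

theorem halfPlane_neg_one : halfPlane (-1) = {z : ℂ | 0 < z.re} := by
  ext z
  simp [halfPlane]

theorem detM₀_ne_zero_and_L_eq (ha : a₁ < a₂) (hν : StrictMono ν)
    (hν_neg : ∀ j : Fin n, ν (Fin.castAdd m j) < 0)
    (hν_pos : ∀ j : Fin m, 0 < ν (Fin.natAdd n j))
    (hγ₁ : IsContour γ₁ {z : ℂ | z.re < 0} (fun j : Fin n => (ν (Fin.castAdd m j) : ℂ)))
    (hγ₂ : IsContour γ₂ {z : ℂ | 0 < z.re} (fun j : Fin m => (ν (Fin.natAdd n j) : ℂ)))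
    {c : ℝ} (hc : 0 ≤ c) {d₁ d₂ : ℂ} (hd₁ : d₁ ≠ 0) (hd₂ : d₂ ≠ 0)
    (hs : s ∈ Set.Ioo (0 : ℝ) 1) (ht : t ∈ Set.Ioo (0 : ℝ) 1) (u v : ℝ) :
    detM₀ a₁ a₂ ν γ₁ γ₂ ≠ 0 ∧ ∃ P Q : Polynomial ℂ, P.degree < n ∧ Q.degree < m ∧
      (∀ k : Fin n, P.eval (ν (Fin.castAdd m k) : ℂ) +
        Complex.exp ((a₂ - a₁ : ℝ) * ν (Fin.castAdd m k)) * Q.eval (ν (Fin.castAdd m k) : ℂ) =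
          expZ a₁ s u (ν (Fin.castAdd m k))) ∧
      (∀ l : Fin m, P.eval (ν (Fin.natAdd n l) : ℂ) +
        Complex.exp ((a₂ - a₁ : ℝ) * ν (Fin.natAdd n l)) * Q.eval (ν (Fin.natAdd n l) : ℂ) = 0) ∧
      L a₁ a₂ ν γ₁ γ₂ d₁ d₂ c s u t v =
        (2 * (Real.pi : ℂ) * Complex.I * (Real.sqrt ((1 - s) * (1 - t)) : ℂ))⁻¹ *
          (gaussMoment a₁ t v P + gaussMoment a₂ t v Q) := by
  have hinj : Function.Injective fun j : Fin n => (ν (Fin.castAdd m j) : ℂ) :=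
    Complex.ofReal_injective.comp (hν.injective.comp (Fin.castAdd_injective n m))
  have hinj' : Function.Injective fun j : Fin m => (ν (Fin.natAdd n j) : ℂ) :=
    Complex.ofReal_injective.comp (hν.injective.comp (Fin.natAdd_injective m n))
  obtain ⟨h1, P, Q, h2, h3, h4, h5, h6⟩ := exists_interpolating_expPoly (ε := 1) (a := a₂ - a₁)
    (γ := γ₁) (γ' := γ₂) (p := fun j : Fin n => (ν (Fin.castAdd m j) : ℂ))
    (p' := fun j : Fin m => (ν (Fin.natAdd n j) : ℂ)) (by norm_num) (sub_pos.2 ha)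
    (by rwa [halfPlane_one]) (by rwa [halfPlane_neg_one]) hinj hinj'
    (fun j => by rw [halfPlane_one]; exact hν_neg j)
    (fun j => by rw [halfPlane_neg_one]; exact hν_pos j)
    (fun _ => rfl) (fun _ => rfl) hs ht a₁ u v (c := c) (by linarith) (δ := 1) hd₁ hd₂ (by norm_num)
    (M := M₀ a₁ a₂ ν γ₁ γ₂) (b := fun x => B a₁ a₂ ν γ₁ d₂ c v t x + β a₁ a₂ ν d₂ v t x)
    (g := C a₁ a₂ ν γ₁ γ₂ d₁ u s) (D := lineIntegral 0 fun w => contourIntegral γ₁ fun z =>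
          1 / (w - z) * (expZ a₁ s u z * expW a₁ t v w) *
            ∏ j : Fin n, (1 - w / ν (Fin.castAdd m j)) / (1 - z / ν (Fin.castAdd m j)))
    (by
      intro x y
      unfold M₀
      congr 2
      funext ζ
      congr 1
      funext ω
      rw [prod_one_sub_div, prod_one_sub_div, Complex.exp_sub, div_eq_mul_inv, ← Complex.exp_neg]
      simp only [Complex.ofReal_one]
      ring_nf)
    (by
      intro x
      unfold B β
      congr 3
      · funext w
        congr 1
        funext ζ
        rw [prod_sub_one_div]
        simp only [Complex.ofReal_one, rootProd]
        ring_nf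
      · funext w
        simp only [Complex.ofReal_one, rootProd]
        ring_nf)
    (by
      intro y
      unfold C
      congr 2
      funext z
      congr 1
      funext ω
      rw [prod_sub_one_div, prod_one_div_one_sub]
      simp only [Complex.ofReal_one]
      ring_nf)
    (by
      congr 1
      funext w
      congr 1
      funext z
      rw [prod_one_sub_div, ← neg_sub z w, one_div, inv_neg]
      ring)
  rw [one_mul, add_sub_cancel] at h6
  simp only [Complex.ofReal_one, one_mul, Fintype.card_fin] at h2 h3 h4 h5
  exact ⟨h1, P, Q, h2, h3, h4, h5, h6⟩

theorem detMHat₀_ne_zero_and_LHat_eq (ha : a₁ < a₂) (hν : StrictMono ν)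
    (hν_neg : ∀ j : Fin n, ν (Fin.castAdd m j) < 0)
    (hν_pos : ∀ j : Fin m, 0 < ν (Fin.natAdd n j))
    (hγ₁ : IsContour γ₁ {z : ℂ | z.re < 0} (fun j : Fin n => (ν (Fin.castAdd m j) : ℂ)))
    (hγ₂ : IsContour γ₂ {z : ℂ | 0 < z.re} (fun j : Fin m => (ν (Fin.natAdd n j) : ℂ)))
    {c : ℝ} (hc : c ≤ 0) {d₁ d₂ : ℂ} (hd₁ : d₁ ≠ 0) (hd₂ : d₂ ≠ 0)
    (hs : s ∈ Set.Ioo (0 : ℝ) 1) (ht : t ∈ Set.Ioo (0 : ℝ) 1) (u v : ℝ) :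
    detMHat₀ a₁ a₂ ν γ₁ γ₂ ≠ 0 ∧ ∃ P Q : Polynomial ℂ, P.degree < m ∧ Q.degree < n ∧
      (∀ k : Fin m, P.eval (ν (Fin.natAdd n k) : ℂ) +
        Complex.exp (-((a₂ - a₁ : ℝ) * ν (Fin.natAdd n k))) * Q.eval (ν (Fin.natAdd n k) : ℂ) =
          expZ a₂ s u (ν (Fin.natAdd n k))) ∧
      (∀ l : Fin n, P.eval (ν (Fin.castAdd m l) : ℂ) +
        Complex.exp (-((a₂ - a₁ : ℝ) * ν (Fin.castAdd m l))) *
          Q.eval (ν (Fin.castAdd m l) : ℂ) = 0) ∧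
      LHat a₁ a₂ ν γ₁ γ₂ d₁ d₂ c s u t v =
        (2 * (Real.pi : ℂ) * Complex.I * (Real.sqrt ((1 - s) * (1 - t)) : ℂ))⁻¹ *
          (gaussMoment a₂ t v P + gaussMoment a₁ t v Q) := by
  have hinj : Function.Injective fun j : Fin n => (ν (Fin.castAdd m j) : ℂ) :=
    Complex.ofReal_injective.comp (hν.injective.comp (Fin.castAdd_injective n m))
  have hinj' : Function.Injective fun j : Fin m => (ν (Fin.natAdd n j) : ℂ) :=
    Complex.ofReal_injective.comp (hν.injective.comp (Fin.natAdd_injective m n))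
  obtain ⟨h1, P, Q, h2, h3, h4, h5, h6⟩ := exists_interpolating_expPoly (ε := -1) (a := a₂ - a₁)
    (γ := γ₂) (γ' := γ₁) (p' := fun j : Fin n => (ν (Fin.castAdd m j) : ℂ))
    (p := fun j : Fin m => (ν (Fin.natAdd n j) : ℂ)) (by norm_num) (sub_pos.2 ha)
    (by rwa [halfPlane_neg_one]) (by rwa [neg_neg, halfPlane_one]) hinj' hinj
    (fun j => by rw [halfPlane_neg_one]; exact hν_pos j)
    (fun j => by rw [neg_neg, halfPlane_one]; exact hν_neg j)
    (fun _ => rfl) (fun _ => rfl) hs ht a₂ u v (c := c) (by linarith) (δ := (-1) ^ n) hd₁ hd₂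
    (by rw [← pow_mul, mul_comm, pow_mul, neg_one_sq, one_pow])
    (M := MHat₀ a₁ a₂ ν γ₁ γ₂)
    (b := fun x => BHat a₁ a₂ ν γ₂ d₂ c v t x + βHat a₁ a₂ ν d₂ v t x)
    (g := CHat a₁ a₂ ν γ₁ γ₂ d₁ u s) (D := lineIntegral 0 fun w => contourIntegral γ₂ fun z =>
          1 / (w - z) * (expZ a₂ s u z * expW a₂ t v w) *
            ∏ j : Fin m, (1 - w / ν (Fin.natAdd n j)) / (1 - z / ν (Fin.natAdd n j)))
    (by
      intro x y
      unfold MHat₀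
      congr 2
      funext ζ
      congr 1
      funext ω
      rw [prod_one_sub_div, prod_one_sub_div, Complex.exp_add, ← neg_sub ζ ω, one_div, inv_neg]
      simp only [Complex.ofReal_neg, Complex.ofReal_one]
      ring_nf)
    (by
      intro x
      unfold BHat βHat
      congr 3
      · funext w
        congr 1
        funext ζ
        rw [prod_sub_one_div, prod_sub_one, Fintype.card_fin]
        simp only [Complex.ofReal_neg, Complex.ofReal_one]
        ring_nf
      · funext w
        rw [prod_sub_one, Fintype.card_fin]
        simp only [Complex.ofReal_neg, Complex.ofReal_one]
        ring_nf)
    (by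
      intro y
      unfold CHat
      congr 2
      funext z
      congr 1
      funext ω
      rw [prod_one_sub_div, prod_one_div_sub_one, Fintype.card_fin, ← neg_sub ω z, div_neg]
      simp only [Complex.ofReal_neg, Complex.ofReal_one]
      ring_nf)
    (by
      congr 1
      funext w
      congr 1
      funext z
      rw [prod_one_sub_div, ← neg_sub z w, one_div, inv_neg]
      ring)
  rw [show a₂ + -1 * (a₂ - a₁) = a₁ by ring] at h6
  simp only [Complex.ofReal_neg, Complex.ofReal_one, neg_mul, one_mul, Fintype.card_fin]
    at h2 h3 h4 h5
  exact ⟨h1, P, Q, h2, h3, h4, h5, h6⟩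

end Instances

end NonColliding

theorem theorem1p2 (n m : ℕ) (a₁ a₂ : ℝ) (ha : a₁ < a₂)
    (ν : Fin (n + m) → ℝ) (hν : StrictMono ν)
    (hν_neg : ∀ j : Fin n, ν (Fin.castAdd m j) < 0)
    (hν_pos : ∀ j : Fin m, 0 < ν (Fin.natAdd n j))
    (γ₁ γ₂ : ℝ → ℂ)
    (hγ₁ : NonColliding.IsContour γ₁ {z : ℂ | z.re < 0}
      (fun j : Fin n => (ν (Fin.castAdd m j) : ℂ)))
    (hγ₂ : NonColliding.IsContour γ₂ {z : ℂ | 0 < z.re}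
      (fun j : Fin m => (ν (Fin.natAdd n j) : ℂ)))
    (c c' : ℝ) (hc : 0 ≤ c) (hc' : c' ≤ 0)
    (d₁ d₂ : ℂ) (hd₁ : d₁ ≠ 0) (hd₂ : d₂ ≠ 0)
    (s t : ℝ) (hs : s ∈ Set.Ioo (0 : ℝ) 1) (ht : t ∈ Set.Ioo (0 : ℝ) 1) (u v : ℝ) :
    (∀ K : ℕ, 1 ≤ K →
      (NonColliding.transitionMatrix (NonColliding.startPoints n m a₁ a₂ K) ν).det ≠ 0) ∧
    NonColliding.detM₀ a₁ a₂ ν γ₁ γ₂ ≠ 0 ∧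
    NonColliding.detMHat₀ a₁ a₂ ν γ₁ γ₂ ≠ 0 ∧
    Tendsto (fun K : ℕ => (NonColliding.kernelK a₁ a₂ ν K s u t v : ℂ)) atTop
      (𝓝 (NonColliding.limitKernel a₁ a₂ ν γ₁ γ₂ d₁ d₂ c c' s u t v)) := by
  obtain ⟨hdet, P₁, Q₁, hP₁, hQ₁, hl₁, hr₁, hL⟩ := NonColliding.detM₀_ne_zero_and_L_eq ha hν
    hν_neg hν_pos hγ₁ hγ₂ hc hd₁ hd₂ hs ht u v
  obtain ⟨hdet', P₂, Q₂, hP₂, hQ₂, hr₂, hl₂, hL'⟩ := NonColliding.detMHat₀_ne_zero_and_LHat_eq ha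
    hν hν_neg hν_pos hγ₁ hγ₂ hc' hd₁ hd₂ hs ht u v
  refine ⟨fun K hK => NonColliding.transitionMatrix_det_ne_zero
    (NonColliding.startPoints_strictMono n m ha hK).injective hν, hdet, hdet', ?_⟩
  have he : ∀ (b : ℝ) (x : ℂ),
      Complex.exp (b * x) * NonColliding.expZ b s u x = NonColliding.expZ 0 s u x := by
    intro b x
    rw [NonColliding.expZ_eq_mul, mul_left_comm, ← Complex.exp_add, add_neg_cancel,
      Complex.exp_zero, mul_one]
  have e₁ : ∀ x : ℂ, Complex.exp (a₂ * x) =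
      Complex.exp (a₁ * x) * Complex.exp ((a₂ - a₁ : ℝ) * x) := by
    intro x
    rw [← Complex.exp_add]
    congr 1
    push_cast
    ring
  have e₂ : ∀ x : ℂ, Complex.exp (a₁ * x) =
      Complex.exp (a₂ * x) * Complex.exp (-((a₂ - a₁ : ℝ) * x)) := by
    intro x
    rw [← Complex.exp_add]
    congr 1
    push_cast
    ring
  -- The exponential polynomials of the two halves interpolate at the left and at the right end
  -- points, and vanish at the others, so that their sum interpolates at all end points.
  have hlim := NonColliding.tendsto_kernelK_add_q ha hν hs ht u v (P := P₁ + Q₂) (Q := Q₁ + P₂)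
    ((Polynomial.degree_add_le _ _).trans_lt (max_lt hP₁ hQ₂))
    ((Polynomial.degree_add_le _ _).trans_lt (max_lt hQ₁ hP₂)) (by
      intro k
      rw [Polynomial.eval_add, Polynomial.eval_add]
      induction k using Fin.addCases with
      | left k =>
        rw [← he a₁]
        linear_combination Complex.exp (a₁ * ν (Fin.castAdd m k)) * hl₁ k +
          Q₁.eval (ν (Fin.castAdd m k) : ℂ) * e₁ (ν (Fin.castAdd m k)) +
          Complex.exp (a₂ * ν (Fin.castAdd m k)) * hl₂ k +
          Q₂.eval (ν (Fin.castAdd m k) : ℂ) * e₂ (ν (Fin.castAdd m k))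
      | right k =>
        rw [← he a₂]
        linear_combination Complex.exp (a₁ * ν (Fin.natAdd n k)) * hr₁ k +
          Q₁.eval (ν (Fin.natAdd n k) : ℂ) * e₁ (ν (Fin.natAdd n k)) +
          Complex.exp (a₂ * ν (Fin.natAdd n k)) * hr₂ k +
          Q₂.eval (ν (Fin.natAdd n k) : ℂ) * e₂ (ν (Fin.natAdd n k)))
  have hval : NonColliding.limitKernel a₁ a₂ ν γ₁ γ₂ d₁ d₂ c c' s u t v =
      (2 * (Real.pi : ℂ) * Complex.I * (Real.sqrt ((1 - s) * (1 - t)) : ℂ))⁻¹ *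
        (NonColliding.gaussMoment a₁ t v (P₁ + Q₂) + NonColliding.gaussMoment a₂ t v (Q₁ + P₂)) -
      (NonColliding.q s u t v : ℂ) := by
    rw [NonColliding.limitKernel, hL, hL', NonColliding.gaussMoment_add ht,
      NonColliding.gaussMoment_add ht]
    ring
  rw [hval]
  refine (hlim.sub_const _).congr fun K => ?_
  rw [add_sub_cancel_right]
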